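/- Let $n\ge 2$ be an even integer, $k=n/2$, $\beta\in[0,1)$, let $B$ be the open unit ball of $\mathbb{R}^n$ centred at the origin, let $w$ be one of the radial weights $w_0(x)=\big(\ln\frac1{|x|}\big)^{\beta n/2}$ or $w_1(x)=\big(\ln\frac{e}{|x|}\big)^{\beta n/2}$ on $B$ (also written $w(r)$, $r=|x|$), and put $c_n=\frac{\omega_{n-1}}{k}\binom{n-1}{k-1}$, where $\omega_{n-1}$ is the area of the unit sphere of $\mathbb{R}^n$. Let $\Phi^k_{0,\mathrm{rad}}(B)$ be the set of radially symmetric $u\in C^2(B)\cap C^0(\overline B)$ with $u=0$ on $\partial B$ and $S_j(D^2u)\ge 0$ in $B$ for $j=1,\dots,k$, where $S_j(D^2u)$ is the sum of all $j\times j$ principal minors of the Hessian matrix $D^2u$. For a radial function $u(x)=v(|x|)$ with $v$ locally absolutely continuous on $(0,1)$ and $v(r)\to 0$ as $r\to 1^-$, put $$\|u\|_{\Phi,w}=\Big(c_n\int_0^1 r^{n-k}|v'(r)|^{k+1}w(r)\,dr\Big)^{\frac1{k+1}},$$ and let $\Phi^k_{0,\mathrm{rad}}(B,w)$ be the closure of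 $\{u\in\Phi^k_{0,\mathrm{rad}}(B):\|u\|_{\Phi,w}<\infty\}$, with respect to $\|\cdot\|_{\Phi,w}$, in the space of all such radial functions of finite norm. (a) For every real $\gamma\ge 0$, $$\int_B e^{|u|^\gamma}\,dx<\infty\ \text{ for all } u\in\Phi^k_{0,\mathrm{rad}}(B,w)\quad\Longleftrightarrow\quad \gamma\le\gamma_{n,\beta}:=\frac{n+2}{n(1-\beta)}.$$ (b) For every real $\alpha$, $$\sup\Big\{\int_B e^{\alpha|u|^{\gamma_{n,\beta}}}\,dx\ :\ u\in\Phi^k_{0,\mathrm{rad}}(B,w),\ \|u\|_{\Phi,w}\le 1\Big\}<\infty\quad\Longleftrightarrow\quad \alpha\le\alpha_{n,\beta}:=n\big[c_n^{2/n}(1-\beta)\big]^{\frac1{1-\beta}}.$$ -/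

import Mathlib

open MeasureTheory Set Filter Topology

noncomputable section

/-- The Hessian matrix `D²u(x)` of a function on `ℝⁿ`. -/
def hessianMatrix {n : ℕ} (u : EuclideanSpace ℝ (Fin n) → ℝ) (x : EuclideanSpace ℝ (Fin n)) :
    Matrix (Fin n) (Fin n) ℝ :=
  Matrix.of fun i j =>
    fderiv ℝ (fderiv ℝ u) x (EuclideanSpace.single i 1) (EuclideanSpace.single j 1)

/-- The sum of all `j × j` principal minors of a square matrix. -/
def principalMinorSum {n : ℕ} (j : ℕ) (A : Matrix (Fin n) (Fin n) ℝ) : ℝ :=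
  ∑ s ∈ (Finset.univ : Finset (Fin n)).powersetCard j,
    (A.submatrix (fun i : s => (i : Fin n)) (fun i : s => (i : Fin n))).det

/-- The `j`-th Hessian operator `S_j(D²u)` at `x`. -/
def hessianOp {n : ℕ} (j : ℕ) (u : EuclideanSpace ℝ (Fin n) → ℝ)
    (x : EuclideanSpace ℝ (Fin n)) : ℝ :=
  principalMinorSum j (hessianMatrix u x)

/-- `u` is `k`-admissible on the unit ball `B`: `u ∈ C²(B) ∩ C⁰(closure B)` and
`S_j(D²u) ≥ 0` in `B` for `j = 1, …, k`. -/
structure IsAdmissible {n : ℕ} (k : ℕ) (u : EuclideanSpace ℝ (Fin n) → ℝ) : Prop where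
  contDiffOn : ContDiffOn ℝ 2 u (Metric.ball 0 1)
  continuousOn : ContinuousOn u (Metric.closedBall 0 1)
  hessian_nonneg : ∀ j : ℕ, 1 ≤ j → j ≤ k → ∀ x ∈ Metric.ball (0 : EuclideanSpace ℝ (Fin n)) 1,
    0 ≤ hessianOp j u x

/-- `u` is radially symmetric on the unit ball. -/
def IsRadial {n : ℕ} (u : EuclideanSpace ℝ (Fin n) → ℝ) : Prop :=
  ∀ x ∈ Metric.ball (0 : EuclideanSpace ℝ (Fin n)) 1,
    ∀ y ∈ Metric.ball (0 : EuclideanSpace ℝ (Fin n)) 1, ‖x‖ = ‖y‖ → u x = u y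

/-- The radial `k`-admissible functions on the unit ball that vanish on its boundary. -/
def PhiRad (n k : ℕ) : Set (EuclideanSpace ℝ (Fin n) → ℝ) :=
  {u | IsAdmissible k u ∧ IsRadial u ∧
    ∀ x ∈ Metric.sphere (0 : EuclideanSpace ℝ (Fin n)) 1, u x = 0}

/-- The profile `r ↦ u(r, 0, …, 0)`; for a radial `u` it is the `v` with `u(x) = v(|x|)`. -/
def profile {n : ℕ} (u : EuclideanSpace ℝ (Fin n) → ℝ) (r : ℝ) : ℝ :=
  u (WithLp.toLp 2 fun i : Fin n => if (i : ℕ) = 0 then r else 0)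

/-- `ω_{n-1}`, the area of the unit sphere of `ℝⁿ`. -/
def sphereArea (n : ℕ) : ℝ :=
  ((volume : Measure (EuclideanSpace ℝ (Fin n))).toSphere univ).toReal

/-- `c_n = (ω_{n-1} / k) * binom (n-1) (k-1)`. -/
def cConst (n k : ℕ) : ℝ :=
  sphereArea n / (k : ℝ) * ((n - 1).choose (k - 1) : ℝ)

/-- The weighted norm `(c_n ∫₀¹ r^(n-k) |v'|^(k+1) w dr)^(1/(k+1))` of a radial function with
profile `v`, as an element of `[0, ∞]`. -/
def weightedNorm {n : ℕ} (k : ℕ) (w : ℝ → ℝ) (u : EuclideanSpace ℝ (Fin n) → ℝ) : ENNReal :=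
  (ENNReal.ofReal (cConst n k) *
    ∫⁻ r in Ioo (0 : ℝ) 1,
      ENNReal.ofReal (r ^ (n - k) * |deriv (profile u) r| ^ (k + 1) * w r)) ^ (1 / ((k : ℝ) + 1))

/-- The ambient weighted Sobolev space in which the closure is taken: the radial functions on
the unit ball whose profile is locally absolutely continuous on `(0, 1)` and tends to `0` at `1`,
with finite weighted norm. The value at the origin is irrelevant. -/
def RadialSobolev (n k : ℕ) (w : ℝ → ℝ) : Set (EuclideanSpace ℝ (Fin n) → ℝ) :=
  {u | IsRadial u ∧
    (∀ a b : ℝ, 0 < a → a < b → b < 1 → AbsolutelyContinuousOnInterval (profile u) a b) ∧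
    Tendsto (profile u) (𝓝[<] 1) (𝓝 0) ∧
    weightedNorm k w u < ⊤}

/-- The closure, for the weighted norm, of the radial `k`-admissible functions that vanish on the
boundary and have finite weighted norm. -/
def PhiRadWeighted (n k : ℕ) (w : ℝ → ℝ) : Set (EuclideanSpace ℝ (Fin n) → ℝ) :=
  {u | u ∈ RadialSobolev n k w ∧
    ∀ ε : ENNReal, 0 < ε →
      ∃ φ ∈ PhiRad n k, weightedNorm k w φ < ⊤ ∧ weightedNorm k w (u - φ) < ε}

/-- The weight `w₀(r) = (ln (1/r))^(βn/2)`. -/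
def logWeightZero (n : ℕ) (β : ℝ) (r : ℝ) : ℝ :=
  Real.log (1 / r) ^ (β * (n : ℝ) / 2)

/-- The weight `w₁(r) = (ln (e/r))^(βn/2)`. -/
def logWeightOne (n : ℕ) (β : ℝ) (r : ℝ) : ℝ :=
  Real.log (Real.exp 1 / r) ^ (β * (n : ℝ) / 2)

/-- `γ_{n,β} = (n+2) / (n (1-β))`. -/
def gammaCrit (n : ℕ) (β : ℝ) : ℝ :=
  ((n : ℝ) + 2) / ((n : ℝ) * (1 - β))

/-- `α_{n,β} = n [c_n^(2/n) (1-β)]^(1/(1-β))`. -/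
def alphaCrit (n k : ℕ) (β : ℝ) : ℝ :=
  (n : ℝ) * (cConst n k ^ (2 / (n : ℝ)) * (1 - β)) ^ (1 / (1 - β))

/-- The functional `∫_B e^{α |u|^γ} dx`, as an element of `[0, ∞]`. -/
def expIntegral {n : ℕ} (α γ : ℝ) (u : EuclideanSpace ℝ (Fin n) → ℝ) : ENNReal :=
  ∫⁻ x in Metric.ball (0 : EuclideanSpace ℝ (Fin n)) 1,
    ENNReal.ofReal (Real.exp (α * |u x| ^ γ))

/-- `MT(n, α, β)`: the supremum of `∫_B e^{α |u|^γ} dx`, `γ = γ_{n,β}`, over the closed unit ball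
of the weighted space. -/
def moserSup (n k : ℕ) (w : ℝ → ℝ) (α β : ℝ) : ENNReal :=
  sSup (expIntegral α (gammaCrit n β) '' {u | u ∈ PhiRadWeighted n k w ∧ weightedNorm k w u ≤ 1})

end

/-! Write t = ln(1/r), θ = 1 - β and γ = (k+1)/(kθ), which is `gammaCrit (2 * k) β`. Hölder's
inequality with exponents k+1 and (k+1)/k, the weight being split off, bounds the increment of v
between e^(-s) and e^(-t) by (E(t) - E(s))^(1/(k+1)) ((t^θ - s^θ)/θ)^(k/(k+1)), where E(t) is the
energy outside radius e^(-t) (`ofReal_abs_sub_le_energy`, `abs_sub_le_outerEnergy`). Since w₀ ≤ w₁,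
the energy for w₀ serves both weights. These upper estimates hold on the whole radial Sobolev space.

Letting s → 0 gives |v|^γ = O(t). For a fixed u the tail of the energy is small, so |v|^γ = o(t)
(`exists_abs_le_const_add`), and the factor e^(-nt) from polar coordinates wins: this is finiteness
in (a). For the uniform bound in (b), normalize φ = A|v| so that φ^γ ≤ t and the integral becomes
that of exp(n(φ^γ - t)). Moser's argument (`exists_moser_gap`) shows that the deficit t - φ^γ is at
most l only on a set of measure O(l): a small deficit at s means that nearly all the energy is spent
by s, so φ cannot keep pace much longer. Summing over unit layers of the deficit bounds the integral
(`exists_moser_bound`).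

Sharpness uses `logPotential`, a power δ of a logarithm regularized at scale ε. It is k-admissible
for 0 < δ ≤ 1, because n/j ≥ 2 for j ≤ k (`logPotential_mem_PhiRad`), and its slope is dominated by
that of the singular profile uniformly in ε. With δ = θ and ε = e^(-2m), normalized, it makes the
integral unbounded for every α above the critical one (`moserSup_eq_top`). With ε = 0 and 1/γ < δ <
1/γ_{n,β}, γ now being the supercritical exponent of (a), it has finite energy, lies in the closure
by dominated convergence, and has infinite exponential integral. -/

noncomputable section

/-! ### Moser's one-variable inequality -/

/-- A two-term Hölder inequality for the conjugate exponents `(k+1)/k` and `k+1`. -/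
theorem rpow_add_mul_rpow_le {P a c η : ℝ} (hP0 : 0 ≤ P) (hP1 : P ≤ 1) (ha : 0 ≤ a) (hc : 0 ≤ c)
    (hη : 0 < η) : a ^ P + η ^ (1 - P) * c ^ P ≤ (1 + η) ^ (1 - P) * (a + c) ^ P := by
  have h1 : (0 : ℝ) < 1 + η := by positivity
  have hconc := (Real.concaveOn_rpow hP0 hP1).2 (mem_Ici.2 ha)
    (mem_Ici.2 (div_nonneg hc hη.le)) (by positivity : 0 ≤ 1 / (1 + η))
    (by positivity : 0 ≤ η / (1 + η)) (by field_simp)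
  simp only [smul_eq_mul] at hconc
  have e1 : 1 / (1 + η) * a + η / (1 + η) * (c / η) = (a + c) / (1 + η) := by
    field_simp
  rw [e1, Real.div_rpow (by positivity) h1.le, Real.div_rpow hc hη.le] at hconc
  have e2 : η ^ (1 - P) = η / η ^ P := by rw [Real.rpow_sub hη, Real.rpow_one]
  have e3 : (1 + η) ^ (1 - P) = (1 + η) / (1 + η) ^ P := by rw [Real.rpow_sub h1, Real.rpow_one]
  rw [e2, e3]
  have := mul_le_mul_of_nonneg_left hconc h1.le
  have hp1 : 0 < η ^ P := by positivity
  have hp2 : 0 < (1 + η) ^ P := by positivity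
  calc a ^ P + η / η ^ P * c ^ P
      = (1 + η) * (1 / (1 + η) * a ^ P + η / (1 + η) * (c ^ P / η ^ P)) := by field_simp
    _ ≤ _ := this
    _ = _ := by ring

theorem one_add_pow_le_one_add_two_pow_mul (m : ℕ) {η : ℝ} (h0 : 0 ≤ η) (h1 : η ≤ 1) :
    (1 + η) ^ m ≤ 1 + 2 ^ m * η := by
  -- The slope 2^m - 1 is that of the chord over [0, 1]; unlike 2^m, it closes the induction.
  suffices h : (1 + η) ^ m ≤ 1 + (2 ^ m - 1) * η by linarith
  induction m with
  | zero => simp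
  | succ m ih =>
    have h2 : (1 : ℝ) ≤ 2 ^ m := one_le_pow₀ (by norm_num)
    calc (1 + η) ^ (m + 1) = (1 + η) ^ m * (1 + η) := pow_succ _ _
      _ ≤ (1 + (2 ^ m - 1) * η) * (1 + η) := by gcongr
      _ ≤ 1 + (2 ^ (m + 1) - 1) * η := by
        rw [pow_succ]
        nlinarith [mul_nonneg (mul_nonneg (sub_nonneg.2 h2) h0) (sub_nonneg.2 h1)]

/-- If `s - l ≤ (g^(1/(k+1)) s^(θk/(k+1)))^γ` with `γ = (k+1)/(kθ)`, then `g` is close to `1`. -/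
theorem one_sub_le_of_sub_le_rpow {k : ℕ} (hk : 1 ≤ k) {θ : ℝ} (h0 : 0 < θ) (h1 : θ ≤ 1)
    {g s l : ℝ} (hg : 0 ≤ g) (hl : 0 ≤ l) (hls : l ≤ s) (hs : 0 < s)
    (h : s - l ≤ (g ^ (1 / ((k : ℝ) + 1)) * (s ^ θ) ^ ((k : ℝ) / (k + 1))) ^
      (((k : ℝ) + 1) / (k * θ))) : 1 - g ≤ k * l / s := by
  have hk0 : (0 : ℝ) < k := by exact_mod_cast hk
  have e : (g ^ (1 / ((k : ℝ) + 1)) * (s ^ θ) ^ ((k : ℝ) / (k + 1))) ^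
      (((k : ℝ) + 1) / (k * θ)) = g ^ (1 / (k * θ)) * s := by
    rw [Real.mul_rpow (by positivity) (by positivity), ← Real.rpow_mul hg, ← Real.rpow_mul hs.le,
      ← Real.rpow_mul hs.le]
    have : θ * ((k : ℝ) / (k + 1)) * (((k : ℝ) + 1) / (k * θ)) = 1 := by field_simp
    rw [this, Real.rpow_one]
    congr 2
    field_simp
  rw [e] at h
  set x := 1 - l / s with hx
  have hls1 : l / s ≤ 1 := by rw [div_le_one hs]; exact hls
  have hls0 : 0 ≤ l / s := by positivity
  have hx0 : 0 ≤ x := by linarith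
  have hxg : x ≤ g ^ (1 / (k * θ)) := by
    have : x * s ≤ g ^ (1 / (k * θ)) * s := by
      rw [hx, sub_mul, div_mul_cancel₀ _ hs.ne', one_mul]; exact h
    exact le_of_mul_le_mul_right this hs
  -- Here x ≤ 1 and θ ≤ 1 replace the exponent kθ by k, after which Bernoulli's inequality applies.
  have hxθ : x ≤ x ^ θ := by
    simpa using Real.rpow_le_rpow_of_exponent_ge' hx0 (by linarith) h0.le h1
  have h3 : x ^ k ≤ g := by
    have h4 : x ^ θ ≤ g ^ (1 / (k : ℝ)) := by
      calc x ^ θ ≤ (g ^ (1 / (k * θ))) ^ θ := Real.rpow_le_rpow hx0 hxg h0.le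
        _ = g ^ (1 / (k : ℝ)) := by
          rw [← Real.rpow_mul hg]; congr 1; field_simp
    calc x ^ k ≤ (g ^ (1 / (k : ℝ))) ^ k := pow_le_pow_left₀ hx0 (hxθ.trans h4) k
      _ = g := by
        rw [← Real.rpow_natCast, ← Real.rpow_mul hg, one_div, inv_mul_cancel₀ hk0.ne',
          Real.rpow_one]
  have h5 := one_add_mul_le_pow (a := -(l / s)) (by linarith) k
  have h6 : (1 + -(l / s)) = x := by rw [hx]; ring
  rw [h6] at h5
  have : k * l / s = k * (l / s) := by ring
  rw [this]
  linarith

/-- The gap estimate behind Moser's inequality: beyond `K l`, the points at which `φ ^ γ` comes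
within `l` of its maximal growth `t` lie in an interval of length `K l`. -/
theorem exists_moser_gap {k : ℕ} (hk : 1 ≤ k) {θ : ℝ} (h0 : 0 < θ) (h1 : θ ≤ 1) :
    ∃ K : ℝ, 0 < K ∧ ∀ φ G : ℝ → ℝ, (∀ t, 0 ≤ φ t) → (∀ t, 0 ≤ G t) → (∀ t, G t ≤ 1) →
      (∀ t, 0 < t → φ t ≤ G t ^ (1 / ((k : ℝ) + 1)) * (t ^ θ) ^ ((k : ℝ) / (k + 1))) →
      (∀ s t, 0 < s → s ≤ t → φ t ≤ φ s +
        (G t - G s) ^ (1 / ((k : ℝ) + 1)) * (t ^ θ - s ^ θ) ^ ((k : ℝ) / (k + 1))) →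
      (∀ s t, 0 < s → s ≤ t → G s ≤ G t) →
      ∀ l s t : ℝ, 0 < l → K * l ≤ s → s ≤ t →
        s - l ≤ φ s ^ (((k : ℝ) + 1) / (k * θ)) → t - l ≤ φ t ^ (((k : ℝ) + 1) / (k * θ)) →
        t - s ≤ K * l := by
  have hk0 : (0 : ℝ) < k := by exact_mod_cast hk
  have hk1 : (1 : ℝ) ≤ k := by exact_mod_cast hk
  obtain ⟨m, hm⟩ := exists_nat_ge (1 / θ)
  have h2m : (1 : ℝ) ≤ 2 ^ m := one_le_pow₀ (by norm_num)
  have h4k : (1 : ℝ) ≤ 4 ^ k := one_le_pow₀ (by norm_num)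
  set C : ℝ := 2 ^ m * (4 ^ k * k) with hC
  have hCk : 4 ^ k * k ≤ C := le_mul_of_one_le_left (by positivity) h2m
  have hC1 : 1 ≤ C := le_trans (one_le_mul_of_one_le_of_one_le h4k hk1) hCk
  refine ⟨2 * (C + 1), by positivity, ?_⟩
  intro φ G hφ hG0 hG1 hφG hinc hGmono l s t hl hKs hst hs ht
  have hCl : C * l ≤ s := by nlinarith
  have hls : l ≤ s := by nlinarith
  have hs0 : 0 < s := by linarith
  have ht0 : 0 < t := by linarith
  have hGs : 1 - G s ≤ k * l / s := by
    refine one_sub_le_of_sub_le_rpow hk h0 h1 (hG0 s) hl.le hls hs0 (hs.trans ?_)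
    exact Real.rpow_le_rpow (hφ s) (hφG s hs0) (by positivity)
  set P : ℝ := (k : ℝ) / (k + 1) with hP
  have hP1 : 1 / ((k : ℝ) + 1) = 1 - P := by rw [hP]; field_simp; ring
  rw [hP1] at hinc hφG
  have hPle : P ≤ 1 := by rw [hP, div_le_one (by positivity)]; linarith
  have hP0 : 0 ≤ P := by positivity
  have hsθ : s ^ θ ≤ t ^ θ := Real.rpow_le_rpow hs0.le hst h0.le
  -- At most kl/s of the energy is left after s. As (4^k)^(1-P) = 4^P, inflating this by 4^k buys a
  -- factor 1/4 on t^θ - s^θ, which makes the later growth strictly slower than t.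
  set η : ℝ := 4 ^ k * (k * l / s) with hη
  have hη0 : 0 < η := by positivity
  have hηC : 2 ^ m * η = C * l / s := by rw [hη, hC]; ring
  have hη1 : η ≤ 1 := by
    have : η = 4 ^ k * k * l / s := by rw [hη]; ring
    rw [this, div_le_one hs0]
    nlinarith
  have hφs : φ s ≤ (s ^ θ) ^ P := by
    refine (hφG s hs0).trans ?_
    exact mul_le_of_le_one_left (by positivity) (Real.rpow_le_one (hG0 s) (hG1 s) (by linarith))
  have hdiff : (G t - G s) ^ (1 - P) * (t ^ θ - s ^ θ) ^ P
      ≤ η ^ (1 - P) * ((t ^ θ - s ^ θ) / 4) ^ P := by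
    have e1 : η ^ (1 - P) * ((t ^ θ - s ^ θ) / 4) ^ P
        = (k * l / s) ^ (1 - P) * (t ^ θ - s ^ θ) ^ P := by
      rw [hη, Real.mul_rpow (by positivity) (by positivity),
        Real.div_rpow (sub_nonneg.2 hsθ) (by norm_num)]
      have : ((4 : ℝ) ^ k) ^ (1 - P) = 4 ^ P := by
        rw [← Real.rpow_natCast, ← Real.rpow_mul (by norm_num), ← hP1]
        congr 1
        rw [hP]; ring
      rw [this]
      have : (0 : ℝ) < 4 ^ P := by positivity
      rw [mul_comm ((4 : ℝ) ^ P), mul_assoc, mul_div_cancel₀ _ this.ne']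
    rw [e1]
    refine mul_le_mul_of_nonneg_right ?_ (Real.rpow_nonneg (by linarith) _)
    exact Real.rpow_le_rpow (by linarith [hGmono s t hs0 hst]) (by linarith [hG1 t])
      (by linarith)
  have hφt : φ t ≤ (1 + η) ^ (1 - P) * (s ^ θ + (t ^ θ - s ^ θ) / 4) ^ P := by
    have := rpow_add_mul_rpow_le hP0 hPle (Real.rpow_nonneg hs0.le θ)
      (by linarith : 0 ≤ (t ^ θ - s ^ θ) / 4) hη0
    linarith [hinc s t hs0 hst]
  have hmix0 : 0 ≤ s ^ θ + (t ^ θ - s ^ θ) / 4 := by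
    have := Real.rpow_nonneg hs0.le θ
    linarith
  -- Convexity of x^(1/θ) at the mixture (3/4)s^θ + (1/4)t^θ.
  have hmix : (s ^ θ + (t ^ θ - s ^ θ) / 4) ^ (1 / θ) ≤ s + (t - s) / 4 := by
    have hconv := (convexOn_rpow (p := 1 / θ) (by rw [le_div_iff₀ h0]; linarith)).2
      (mem_Ici.2 (Real.rpow_nonneg hs0.le θ)) (mem_Ici.2 (Real.rpow_nonneg ht0.le θ))
      (by norm_num : (0 : ℝ) ≤ 3 / 4) (by norm_num : (0 : ℝ) ≤ 1 / 4) (by norm_num)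
    simp only [smul_eq_mul] at hconv
    rw [← Real.rpow_mul hs0.le, ← Real.rpow_mul ht0.le, mul_one_div_cancel h0.ne',
      Real.rpow_one, Real.rpow_one] at hconv
    calc _ = (3 / 4 * s ^ θ + 1 / 4 * t ^ θ) ^ (1 / θ) := by congr 1; ring
      _ ≤ _ := hconv
      _ = _ := by ring
  have hfin : t - l ≤ (1 + C * l / s) * (s + (t - s) / 4) := by
    calc t - l ≤ φ t ^ (((k : ℝ) + 1) / (k * θ)) := ht
      _ ≤ ((1 + η) ^ (1 - P) * (s ^ θ + (t ^ θ - s ^ θ) / 4) ^ P) ^ (((k : ℝ) + 1) / (k * θ)) :=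
        Real.rpow_le_rpow (hφ t) hφt (by positivity)
      _ = (1 + η) ^ (1 / (k * θ)) * (s ^ θ + (t ^ θ - s ^ θ) / 4) ^ (1 / θ) := by
        rw [Real.mul_rpow (by positivity) (by positivity), ← Real.rpow_mul (by positivity),
          ← Real.rpow_mul hmix0, ← hP1]
        congr 2
        · field_simp
        · rw [hP]; field_simp
      _ ≤ (1 + C * l / s) * (s + (t - s) / 4) := by
        refine mul_le_mul ?_ hmix (by positivity) (by positivity)
        rw [← hηC]
        refine le_trans ?_ (one_add_pow_le_one_add_two_pow_mul m hη0.le hη1)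
        rw [← Real.rpow_natCast]
        refine Real.rpow_le_rpow_of_exponent_le (by linarith) (le_trans ?_ hm)
        apply one_div_le_one_div_of_le h0
        nlinarith
  -- Since Cl/s ≤ 1, the two terms containing t - s add up to at most (t - s)/2. Absorbing them on
  -- the left gives t - s ≤ 2(C + 1)l.
  have hexp : (1 + C * l / s) * (s + (t - s) / 4)
      = s + C * l + (t - s) / 4 + C * l / s * ((t - s) / 4) := by
    field_simp
    ring
  have : C * l / s ≤ 1 := by rw [div_le_one hs0]; exact hCl
  have h7 : C * l / s * ((t - s) / 4) ≤ (t - s) / 4 :=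
    mul_le_of_le_one_left (by linarith) this
  linarith

/-- Moser's inequality in one variable. -/
theorem exists_moser_bound {k : ℕ} (hk : 1 ≤ k) {θ : ℝ} (h0 : 0 < θ) (h1 : θ ≤ 1) :
    ∃ C : ENNReal, C < ⊤ ∧ ∀ N : ℝ, 1 ≤ N → ∀ φ G : ℝ → ℝ, (∀ t, 0 ≤ φ t) → (∀ t, 0 ≤ G t) →
      (∀ t, G t ≤ 1) →
      (∀ t, 0 < t → φ t ≤ G t ^ (1 / ((k : ℝ) + 1)) * (t ^ θ) ^ ((k : ℝ) / (k + 1))) →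
      (∀ s t, 0 < s → s ≤ t → φ t ≤ φ s +
        (G t - G s) ^ (1 / ((k : ℝ) + 1)) * (t ^ θ - s ^ θ) ^ ((k : ℝ) / (k + 1))) →
      (∀ s t, 0 < s → s ≤ t → G s ≤ G t) →
      ∫⁻ t in Ioi (0 : ℝ),
        ENNReal.ofReal (Real.exp (N * (φ t ^ (((k : ℝ) + 1) / (k * θ)) - t))) ≤ C := by
  obtain ⟨K, hK, hgap⟩ := exists_moser_gap hk h0 h1
  have hk0 : (0 : ℝ) < k := by exact_mod_cast hk
  have hsum : Summable fun j : ℕ => Real.exp (-(j : ℝ)) * (2 * (K * ((j : ℝ) + 1))) := by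
    have e : ∀ j : ℕ, Real.exp (-(j : ℝ)) = Real.exp (-1) ^ j := fun j => by
      rw [← Real.exp_nat_mul]; congr 1; ring
    have hr : ‖Real.exp (-1)‖ < 1 := by
      rw [Real.norm_eq_abs, Real.abs_exp, Real.exp_lt_one_iff]; norm_num
    have s1 := summable_pow_mul_geometric_of_norm_lt_one 1 hr
    have s0 := summable_geometric_of_norm_lt_one hr
    refine ((s1.add s0).mul_left (2 * K)).congr fun j => ?_
    rw [e]; ring
  refine ⟨∑' j : ℕ, ENNReal.ofReal (Real.exp (-(j : ℝ)) * (2 * (K * ((j : ℝ) + 1)))),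
    ?_, ?_⟩
  · rw [← ENNReal.ofReal_tsum_of_nonneg (fun j => by positivity) hsum]
    exact ENNReal.ofReal_lt_top
  intro N hN φ G hφ hG0 hG1 hφG hinc hGmono
  set γ : ℝ := ((k : ℝ) + 1) / (k * θ) with hγ
  have hγ0 : 0 ≤ γ := by positivity
  have hle : ∀ t, 0 < t → φ t ^ γ ≤ t := by
    intro t ht
    have h2 : φ t ≤ (t ^ θ) ^ ((k : ℝ) / (k + 1)) := by
      refine (hφG t ht).trans ?_
      exact mul_le_of_le_one_left (by positivity)
        (Real.rpow_le_one (hG0 t) (hG1 t) (by positivity))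
    calc φ t ^ γ ≤ ((t ^ θ) ^ ((k : ℝ) / (k + 1))) ^ γ := Real.rpow_le_rpow (hφ t) h2 hγ0
      _ = t := by
        rw [← Real.rpow_mul ht.le, ← Real.rpow_mul ht.le]
        have : θ * ((k : ℝ) / (k + 1)) * γ = 1 := by rw [hγ]; field_simp
        rw [this, Real.rpow_one]
  -- Unit layers of the deficit t - φ^γ, which is nonnegative by `hle`.
  set S : ℕ → Set ℝ := fun j => {t | 0 < t ∧ (j : ℝ) ≤ t - φ t ^ γ ∧ t - φ t ^ γ < j + 1} with hS
  have hcover : Ioi (0 : ℝ) ⊆ ⋃ j, S j := by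
    intro t ht
    have hnn : 0 ≤ t - φ t ^ γ := sub_nonneg.2 (hle t ht)
    exact mem_iUnion.2 ⟨⌊t - φ t ^ γ⌋₊, ht, Nat.floor_le hnn, Nat.lt_floor_add_one _⟩
  have hvol : ∀ j, volume (S j) ≤ ENNReal.ofReal (2 * (K * ((j : ℝ) + 1))) := by
    intro j
    have hj : (0 : ℝ) < (j : ℝ) + 1 := by positivity
    -- Below K(j+1) the layer has at most the length of that interval; above it the gap estimate
    -- with l = j + 1 bounds its diameter.
    have hsub : S j ⊆ Ioc 0 (K * (j + 1)) ∪ (S j ∩ Ici (K * (j + 1))) := by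
      intro t ht
      rcases le_total t (K * (j + 1)) with h | h
      · exact Or.inl ⟨ht.1, h⟩
      · exact Or.inr ⟨ht, h⟩
    have hdiam : volume (S j ∩ Ici (K * ((j : ℝ) + 1))) ≤ ENNReal.ofReal (K * (j + 1)) := by
      refine (Real.volume_le_diam _).trans (Metric.ediam_le fun x hx y hy => ?_)
      rw [edist_dist, Real.dist_eq]
      apply ENNReal.ofReal_le_ofReal
      have key : ∀ x y, x ∈ S j ∩ Ici (K * ((j : ℝ) + 1)) → y ∈ S j ∩ Ici (K * ((j : ℝ) + 1)) →
          x ≤ y → y - x ≤ K * (j + 1) := fun x y hx hy hxy =>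
        hgap φ G hφ hG0 hG1 hφG hinc hGmono (j + 1) x y hj hx.2 hxy
          (by linarith [hx.1.2.2]) (by linarith [hy.1.2.2])
      rcases le_total x y with h | h
      · rw [abs_of_nonpos (by linarith)]; linarith [key x y hx hy h]
      · rw [abs_of_nonneg (by linarith)]; linarith [key y x hy hx h]
    calc volume (S j) ≤ _ := measure_mono hsub
      _ ≤ _ := measure_union_le _ _
      _ ≤ ENNReal.ofReal (K * (j + 1)) + ENNReal.ofReal (K * (j + 1)) := by
        gcongr
        rw [Real.volume_Ioc, sub_zero]
      _ = _ := by
        rw [← ENNReal.ofReal_add (by positivity) (by positivity)]; congr 1; ring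
  -- Since φ is not assumed measurable, each layer is replaced by a measurable hull of the same
  -- measure.
  set M : ℕ → Set ℝ := fun j => toMeasurable volume (S j) with hM
  calc ∫⁻ t in Ioi (0 : ℝ), ENNReal.ofReal (Real.exp (N * (φ t ^ γ - t)))
      ≤ ∫⁻ t in Ioi (0 : ℝ),
          ∑' j, (M j).indicator (fun _ => ENNReal.ofReal (Real.exp (-(j : ℝ)))) t := by
        refine setLIntegral_mono' measurableSet_Ioi fun t ht => ?_
        obtain ⟨j, hj⟩ := mem_iUnion.1 (hcover ht)
        refine le_trans ?_ (ENNReal.le_tsum j)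
        rw [indicator_of_mem (subset_toMeasurable _ _ hj)]
        refine ENNReal.ofReal_le_ofReal (Real.exp_le_exp.2 ?_)
        have := hj.2.1
        have hj0 : (0 : ℝ) ≤ j := by positivity
        nlinarith
    _ ≤ ∫⁻ t, ∑' j, (M j).indicator (fun _ => ENNReal.ofReal (Real.exp (-(j : ℝ)))) t :=
        setLIntegral_le_lintegral _ _
    _ = ∑' j : ℕ, ENNReal.ofReal (Real.exp (-(j : ℝ))) * volume (S j) := by
        rw [lintegral_tsum fun j =>
          (measurable_const.indicator (measurableSet_toMeasurable _ _)).aemeasurable]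
        congr 1
        ext j
        rw [lintegral_indicator_const (measurableSet_toMeasurable _ _), measure_toMeasurable]
    _ ≤ _ := by
      refine ENNReal.tsum_le_tsum fun j => ?_
      rw [ENNReal.ofReal_mul (Real.exp_pos _).le]
      gcongr
      exact hvol j

/-! ### Weighted energy and growth of profiles -/

/-- The density `r^k |v'|^(k+1) (ln (1/r))^(βk)` of the weighted energy. -/
def energyDensity (k : ℕ) (β : ℝ) (v : ℝ → ℝ) (r : ℝ) : ENNReal :=
  ENNReal.ofReal (r ^ k * |deriv v r| ^ (k + 1) * Real.log (1 / r) ^ (β * k))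

theorem log_one_div_pos {r : ℝ} (h0 : 0 < r) (h1 : r < 1) : 0 < Real.log (1 / r) :=
  Real.log_pos (by rw [one_div]; exact (one_lt_inv₀ h0).2 h1)

theorem hasDerivAt_log_one_div_rpow {θ r : ℝ} (hθ : θ ≠ 0) (h0 : 0 < r) (h1 : r < 1) :
    HasDerivAt (fun x => -(Real.log (1 / x) ^ θ / θ)) (r⁻¹ * Real.log (1 / r) ^ (θ - 1)) r := by
  have hl := log_one_div_pos h0 h1
  have h2 : HasDerivAt (fun x : ℝ => Real.log (1 / x)) (-r⁻¹) r := by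
    simp only [one_div, Real.log_inv]
    exact (Real.hasDerivAt_log h0.ne').neg
  have h3 := ((h2.rpow_const (p := θ) (Or.inl hl.ne')).div_const θ).neg
  refine h3.congr_deriv ?_
  field_simp

theorem lintegral_inv_mul_log_rpow {θ r R : ℝ} (hθ : 0 < θ) (h0 : 0 < r) (hrR : r ≤ R)
    (h1 : R < 1) :
    ∫⁻ x in Ioc r R, ENNReal.ofReal (x⁻¹ * Real.log (1 / x) ^ (θ - 1)) =
      ENNReal.ofReal ((Real.log (1 / r) ^ θ - Real.log (1 / R) ^ θ) / θ) := by
  have hpos : ∀ x ∈ Icc r R, 0 < x ∧ x < 1 := fun x hx => ⟨h0.trans_le hx.1, hx.2.trans_lt h1⟩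
  have hcont : ContinuousOn (fun x : ℝ => x⁻¹ * Real.log (1 / x) ^ (θ - 1)) (uIcc r R) := by
    rw [uIcc_of_le hrR]
    intro x hx
    obtain ⟨hx0, hx1⟩ := hpos x hx
    have hl := log_one_div_pos hx0 hx1
    apply ContinuousAt.continuousWithinAt
    refine (continuousAt_inv₀ hx0.ne').mul (ContinuousAt.rpow_const ?_ (Or.inl hl.ne'))
    simp only [one_div, Real.log_inv]
    exact (Real.continuousAt_log hx0.ne').neg
  have hint := hcont.intervalIntegrable (μ := volume)
  have hftc := intervalIntegral.integral_eq_sub_of_hasDerivAt (a := r) (b := R)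
    (f := fun x => -(Real.log (1 / x) ^ θ / θ))
    (f' := fun x => x⁻¹ * Real.log (1 / x) ^ (θ - 1)) (fun x hx => by
      rw [uIcc_of_le hrR] at hx
      exact hasDerivAt_log_one_div_rpow hθ.ne' (hpos x hx).1 (hpos x hx).2) hint
  rw [intervalIntegral.integral_of_le hrR] at hftc
  rw [← ofReal_integral_eq_lintegral_ofReal hint.1, hftc]
  · congr 1; ring
  · refine (ae_restrict_iff' measurableSet_Ioc).2 (Eventually.of_forall fun x hx => ?_)
    obtain ⟨hx0, hx1⟩ := hpos x ⟨hx.1.le, hx.2⟩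
    have hl := log_one_div_pos hx0 hx1
    simp only [Pi.zero_apply]
    positivity

/-- Weighted Hölder estimate for the oscillation of an absolutely continuous profile. -/
theorem ofReal_abs_sub_le_energy {k : ℕ} (hk : 1 ≤ k) {β r R : ℝ} {v : ℝ → ℝ} (hβ : β < 1)
    (h0 : 0 < r) (hrR : r ≤ R) (h1 : R < 1) (hv : AbsolutelyContinuousOnInterval v r R) :
    ENNReal.ofReal |v r - v R| ≤
      (∫⁻ x in Ioc r R, energyDensity k β v x) ^ (1 / ((k : ℝ) + 1)) *
      ENNReal.ofReal ((Real.log (1 / r) ^ (1 - β) - Real.log (1 / R) ^ (1 - β)) / (1 - β)) ^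
        ((k : ℝ) / (k + 1)) := by
  have hk0 : (0 : ℝ) < k := by exact_mod_cast hk
  have hftc := hv.integral_deriv_eq_sub
  have hpq : ((k : ℝ) + 1).HolderConjugate (((k : ℝ) + 1) / k) := by
    rw [Real.holderConjugate_iff]
    refine ⟨by linarith, ?_⟩
    field_simp
    ring
  -- Factorization |v'| = f g: f^(k+1) is the energy density, and g^((k+1)/k) = x⁻¹ ln(1/x)^(-β) has
  -- an explicit primitive.
  set f : ℝ → ENNReal := fun x => ENNReal.ofReal
    ((x ^ k * |deriv v x| ^ (k + 1) * Real.log (1 / x) ^ (β * k)) ^ (1 / ((k : ℝ) + 1))) with hf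
  set g : ℝ → ENNReal := fun x => ENNReal.ofReal
    ((x⁻¹ * Real.log (1 / x) ^ ((1 - β) - 1)) ^ ((k : ℝ) / (k + 1))) with hg
  have hmv := measurable_deriv v
  have hfm : Measurable f := by fun_prop
  have hgm : Measurable g := by fun_prop
  have hpt : ∀ x ∈ Ioc r R, ENNReal.ofReal |deriv v x| = f x * g x ∧
      f x ^ ((k : ℝ) + 1) = energyDensity k β v x ∧
      g x ^ (((k : ℝ) + 1) / k) =
        ENNReal.ofReal (x⁻¹ * Real.log (1 / x) ^ ((1 - β) - 1)) := by
    intro x hx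
    have hx0 : 0 < x := h0.trans hx.1
    have hl := log_one_div_pos hx0 (hx.2.trans_lt h1)
    have habs := abs_nonneg (deriv v x)
    refine ⟨?_, ?_, ?_⟩
    · rw [hf, hg]
      simp only
      rw [← ENNReal.ofReal_mul (by positivity)]
      congr 1
      rw [Real.mul_rpow (by positivity) (by positivity),
        Real.mul_rpow (by positivity) (by positivity),
        Real.mul_rpow (by positivity) (by positivity), ← Real.rpow_natCast, ← Real.rpow_natCast,
        ← Real.rpow_mul hx0.le, ← Real.rpow_mul habs, ← Real.rpow_mul hl.le,
        ← Real.rpow_mul hl.le, Real.inv_rpow hx0.le]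
      have e1 : ((k + 1 : ℕ) : ℝ) * (1 / ((k : ℝ) + 1)) = 1 := by
        push_cast; field_simp
      have e2 : (1 - β - 1) * ((k : ℝ) / (k + 1)) = -(β * k * (1 / ((k : ℝ) + 1))) := by
        field_simp; ring
      rw [e1, Real.rpow_one, e2, Real.rpow_neg hl.le, mul_one_div]
      have p1 : 0 < x ^ ((k : ℝ) / (k + 1)) := by positivity
      have p2 : 0 < Real.log (1 / x) ^ (β * k * (1 / ((k : ℝ) + 1))) := by positivity
      field_simp
    · rw [hf, energyDensity]
      simp only
      rw [ENNReal.ofReal_rpow_of_nonneg (by positivity) (by positivity),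
        ← Real.rpow_mul (by positivity), one_div_mul_cancel (by positivity), Real.rpow_one]
    · rw [hg]
      simp only
      rw [ENNReal.ofReal_rpow_of_nonneg (by positivity) (by positivity),
        ← Real.rpow_mul (by positivity)]
      have : (k : ℝ) / (k + 1) * ((k + 1) / k) = 1 := by field_simp
      rw [this, Real.rpow_one]
  calc ENNReal.ofReal |v r - v R| = ‖∫ x in Ioc r R, deriv v x‖ₑ := by
        rw [← intervalIntegral.integral_of_le hrR, hftc, ← ofReal_norm,
          Real.norm_eq_abs, abs_sub_comm]
    _ ≤ ∫⁻ x in Ioc r R, ‖deriv v x‖ₑ := enorm_integral_le_lintegral_enorm _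
    _ = ∫⁻ x in Ioc r R, (f * g) x := by
        refine setLIntegral_congr_fun measurableSet_Ioc fun x hx => ?_
        simp only [Pi.mul_apply]
        rw [← (hpt x hx).1, ← ofReal_norm, Real.norm_eq_abs]
    _ ≤ _ := ENNReal.lintegral_mul_le_Lp_mul_Lq _ hpq hfm.aemeasurable hgm.aemeasurable
    _ = _ := by
        rw [setLIntegral_congr_fun measurableSet_Ioc fun x hx => (hpt x hx).2.1,
          setLIntegral_congr_fun measurableSet_Ioc fun x hx => (hpt x hx).2.2,
          lintegral_inv_mul_log_rpow (by linarith) h0 hrR h1, one_div_div]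

/-- The energy of `v` outside the ball of radius `e^(-t)`. -/
def outerEnergy (k : ℕ) (β : ℝ) (v : ℝ → ℝ) (t : ℝ) : ℝ :=
  (∫⁻ x in Ioo (Real.exp (-t)) 1, energyDensity k β v x).toReal

/-- The total energy of `v`. -/
def totalEnergy (k : ℕ) (β : ℝ) (v : ℝ → ℝ) : ENNReal :=
  ∫⁻ x in Ioo (0 : ℝ) 1, energyDensity k β v x

section
variable {k : ℕ} {β : ℝ} {v : ℝ → ℝ}

theorem outerEnergy_nonneg (t : ℝ) : 0 ≤ outerEnergy k β v t := ENNReal.toReal_nonneg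

theorem lintegral_Ioo_exp_le (t : ℝ) :
    ∫⁻ x in Ioo (Real.exp (-t)) 1, energyDensity k β v x ≤ totalEnergy k β v :=
  lintegral_mono_set (Ioo_subset_Ioo_left (Real.exp_pos _).le)

theorem outerEnergy_le (hE : totalEnergy k β v < ⊤) (t : ℝ) :
    outerEnergy k β v t ≤ (totalEnergy k β v).toReal :=
  ENNReal.toReal_mono hE.ne (lintegral_Ioo_exp_le t)

theorem outerEnergy_mono (hE : totalEnergy k β v < ⊤) {s t : ℝ} (hst : s ≤ t) :
    outerEnergy k β v s ≤ outerEnergy k β v t :=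
  ENNReal.toReal_mono ((lintegral_Ioo_exp_le t).trans_lt hE).ne
    (lintegral_mono_set (Ioo_subset_Ioo_left (Real.exp_le_exp.2 (neg_le_neg hst))))

theorem lintegral_Ioc_exp_le (hE : totalEnergy k β v < ⊤) {s t : ℝ} (h0 : 0 < s) (hst : s ≤ t) :
    ∫⁻ x in Ioc (Real.exp (-t)) (Real.exp (-s)), energyDensity k β v x ≤
      ENNReal.ofReal (outerEnergy k β v t - outerEnergy k β v s) := by
  have h1 : Real.exp (-s) < 1 := Real.exp_lt_one_iff.2 (by linarith)
  have hle : Real.exp (-t) ≤ Real.exp (-s) := Real.exp_le_exp.2 (by linarith)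
  have hu : Ioo (Real.exp (-t)) 1 =
      Ioc (Real.exp (-t)) (Real.exp (-s)) ∪ Ioo (Real.exp (-s)) 1 :=
    (Ioc_union_Ioo_eq_Ioo hle h1).symm
  have hd : Disjoint (Ioc (Real.exp (-t)) (Real.exp (-s))) (Ioo (Real.exp (-s)) 1) :=
    Set.disjoint_left.2 fun x hx hx' => absurd hx.2 (not_le.2 hx'.1)
  have hfin : ∫⁻ x in Ioo (Real.exp (-s)) 1, energyDensity k β v x ≠ ⊤ :=
    ((lintegral_Ioo_exp_le s).trans_lt hE).ne
  have hfin' : ∫⁻ x in Ioc (Real.exp (-t)) (Real.exp (-s)), energyDensity k β v x ≠ ⊤ := by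
    refine ((lintegral_mono_set ?_).trans_lt hE).ne
    exact fun x hx => ⟨(Real.exp_pos _).trans hx.1, hx.2.trans_lt h1⟩
  rw [outerEnergy, outerEnergy, hu, lintegral_union measurableSet_Ioo hd,
    ENNReal.toReal_add hfin' hfin, add_sub_cancel_right, ENNReal.ofReal_toReal hfin']

theorem abs_sub_le_outerEnergy (hk : 1 ≤ k) (hβ : β < 1)
    (hac : ∀ a b : ℝ, 0 < a → a < b → b < 1 → AbsolutelyContinuousOnInterval v a b)
    (hE : totalEnergy k β v < ⊤) {s t : ℝ} (h0 : 0 < s) (hst : s ≤ t) :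
    |v (Real.exp (-t)) - v (Real.exp (-s))| ≤
      (outerEnergy k β v t - outerEnergy k β v s) ^ (1 / ((k : ℝ) + 1)) *
      ((t ^ (1 - β) - s ^ (1 - β)) / (1 - β)) ^ ((k : ℝ) / (k + 1)) := by
  have hd0 : 0 ≤ outerEnergy k β v t - outerEnergy k β v s :=
    sub_nonneg.2 (outerEnergy_mono hE hst)
  have hp0 : 0 ≤ (t ^ (1 - β) - s ^ (1 - β)) / (1 - β) :=
    div_nonneg (sub_nonneg.2 (Real.rpow_le_rpow h0.le hst (by linarith))) (by linarith)
  rcases hst.eq_or_lt with rfl | hlt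
  · simp only [sub_self, abs_zero]; positivity
  have h1 : Real.exp (-s) < 1 := Real.exp_lt_one_iff.2 (by linarith)
  have hle : Real.exp (-t) < Real.exp (-s) := Real.exp_lt_exp.2 (by linarith)
  have key := ofReal_abs_sub_le_energy hk hβ (Real.exp_pos (-t)) hle.le h1
    (hac _ _ (Real.exp_pos _) hle h1)
  simp only [one_div, Real.log_inv, Real.log_exp, neg_neg] at key
  have key2 := key.trans (mul_le_mul_left (ENNReal.rpow_le_rpow
    (lintegral_Ioc_exp_le hE h0 hst) (by positivity)) _)
  rw [ENNReal.ofReal_rpow_of_nonneg hd0 (by positivity),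
    ENNReal.ofReal_rpow_of_nonneg hp0 (by positivity), ← ENNReal.ofReal_mul (by positivity)] at key2
  rw [one_div]
  exact (ENNReal.ofReal_le_ofReal_iff (by positivity)).1 key2

theorem abs_le_add_outerEnergy (hk : 1 ≤ k) (hβ : β < 1)
    (hac : ∀ a b : ℝ, 0 < a → a < b → b < 1 → AbsolutelyContinuousOnInterval v a b)
    (hE : totalEnergy k β v < ⊤) {s t : ℝ} (h0 : 0 < s) (hst : s ≤ t) :
    |v (Real.exp (-t))| ≤ |v (Real.exp (-s))| +
      (outerEnergy k β v t - outerEnergy k β v s) ^ (1 / ((k : ℝ) + 1)) *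
      ((t ^ (1 - β) - s ^ (1 - β)) / (1 - β)) ^ ((k : ℝ) / (k + 1)) := by
  have h1 := abs_sub_le_outerEnergy hk hβ hac hE h0 hst
  have h2 := abs_sub_abs_le_abs_sub (v (Real.exp (-t))) (v (Real.exp (-s)))
  linarith

/-- The limit s → 0 of the increment estimate; this is where the zero boundary value enters. -/
theorem abs_le_outerEnergy (hk : 1 ≤ k) (hβ : β < 1)
    (hac : ∀ a b : ℝ, 0 < a → a < b → b < 1 → AbsolutelyContinuousOnInterval v a b)
    (hlim : Tendsto v (𝓝[<] 1) (𝓝 0))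
    (hE : totalEnergy k β v < ⊤) {t : ℝ} (h0 : 0 < t) :
    |v (Real.exp (-t))| ≤ outerEnergy k β v t ^ (1 / ((k : ℝ) + 1)) *
      (t ^ (1 - β) / (1 - β)) ^ ((k : ℝ) / (k + 1)) := by
  have hexp : Tendsto (fun s : ℝ => Real.exp (-s)) (𝓝[>] 0) (𝓝[<] 1) := by
    refine tendsto_nhdsWithin_iff.2 ⟨?_, ?_⟩
    · have : Tendsto (fun s : ℝ => Real.exp (-s)) (𝓝 0) (𝓝 (Real.exp (-0))) :=
        (Real.continuous_exp.comp continuous_neg).tendsto 0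
      simpa using this.mono_left nhdsWithin_le_nhds
    · filter_upwards [self_mem_nhdsWithin] with s hs
      exact Real.exp_lt_one_iff.2 (by have : 0 < s := hs; linarith)
  have hl : Tendsto (fun s : ℝ => |v (Real.exp (-t)) - v (Real.exp (-s))|) (𝓝[>] 0)
      (𝓝 |v (Real.exp (-t)) - 0|) := (tendsto_const_nhds.sub (hlim.comp hexp)).abs
  rw [sub_zero] at hl
  refine le_of_tendsto hl ?_
  filter_upwards [Ioo_mem_nhdsGT h0] with s hs
  have hθ : 0 < 1 - β := by linarith
  refine (abs_sub_le_outerEnergy hk hβ hac hE hs.1 hs.2.le).trans ?_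
  have h3 : s ^ (1 - β) ≤ t ^ (1 - β) := Real.rpow_le_rpow hs.1.le hs.2.le hθ.le
  have h4 : 0 ≤ s ^ (1 - β) := Real.rpow_nonneg hs.1.le _
  refine mul_le_mul ?_ ?_ (Real.rpow_nonneg (div_nonneg (by linarith) hθ.le) _)
    (Real.rpow_nonneg (outerEnergy_nonneg t) _)
  · exact Real.rpow_le_rpow (sub_nonneg.2 (outerEnergy_mono hE hs.2.le))
      (by linarith [outerEnergy_nonneg (k := k) (β := β) (v := v) s]) (by positivity)
  · exact Real.rpow_le_rpow (div_nonneg (by linarith) hθ.le)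
      (div_le_div_of_nonneg_right (by linarith) hθ.le) (by positivity)

end

/-! ### Logarithmic polar coordinates -/

/-- The substitution `r = e^(-t)` on `(0, 1)`. -/
theorem lintegral_Ioo_zero_one_eq (F : ℝ → ENNReal) :
    ∫⁻ r in Ioo (0 : ℝ) 1, F r =
      ∫⁻ t in Ioi (0 : ℝ), ENNReal.ofReal (Real.exp (-t)) * F (Real.exp (-t)) := by
  have himg : (fun t : ℝ => Real.exp (-t)) '' Ioi 0 = Ioo 0 1 := by
    ext r
    constructor
    · rintro ⟨t, ht, rfl⟩
      exact ⟨Real.exp_pos _, Real.exp_lt_one_iff.2 (neg_lt_zero.2 ht)⟩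
    · rintro ⟨h0, h1⟩
      exact ⟨-Real.log r, neg_pos.2 (Real.log_neg h0 h1), by simp [Real.exp_log h0]⟩
  have h5 := lintegral_image_eq_lintegral_abs_deriv_mul (s := Ioi (0 : ℝ))
    (f := fun t => Real.exp (-t)) (f' := fun t => -Real.exp (-t)) measurableSet_Ioi
    (fun t _ => by
      have := (hasDerivAt_neg t).exp
      simpa using this.hasDerivWithinAt)
    (fun a _ b _ h => neg_injective (Real.exp_injective h))
    F
  rw [himg] at h5
  simpa only [abs_neg, Real.abs_exp] using h5

/-- Polar coordinates with the logarithmic radial variable `t = ln (1/|x|)`. -/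
theorem lintegral_ball_norm_eq {n : ℕ} (hn : 1 ≤ n) {f : ℝ → ENNReal} (hf : Measurable f) :
    ∫⁻ x in Metric.ball (0 : EuclideanSpace ℝ (Fin n)) 1, f ‖x‖ =
      (volume : Measure (EuclideanSpace ℝ (Fin n))).toSphere univ *
        ∫⁻ t in Ioi (0 : ℝ), ENNReal.ofReal (Real.exp (-(n * t))) * f (Real.exp (-t)) := by
  have : Nonempty (Fin n) := ⟨⟨0, hn⟩⟩
  set E := EuclideanSpace ℝ (Fin n)
  set μ : Measure E := volume
  set F : ℝ → ENNReal := (Iio 1).indicator f with hF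
  have hFm : Measurable F := hf.indicator measurableSet_Iio
  have hdim : Module.finrank ℝ E = n := by simp [E]
  have h1 : ∫⁻ x in Metric.ball (0 : E) 1, f ‖x‖ ∂μ = ∫⁻ x, F ‖x‖ ∂μ := by
    rw [← lintegral_indicator measurableSet_ball]
    refine lintegral_congr fun x => ?_
    by_cases hx : ‖x‖ < 1 <;> simp [hF, indicator, hx]
  have h2 : ∫⁻ x, F ‖x‖ ∂μ = ∫⁻ x : ({(0)}ᶜ : Set E), F ‖x.1‖ ∂(μ.comap (↑)) := by
    rw [lintegral_subtype_comap (measurableSet_singleton _).compl (fun x : E => F ‖x‖),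
      restrict_compl_singleton]
  have h3 : ∫⁻ x : ({(0)}ᶜ : Set E), F ‖x.1‖ ∂(μ.comap (↑)) =
      ∫⁻ x, F x.2 ∂μ.toSphere.prod (.volumeIoiPow (Module.finrank ℝ E - 1)) := by
    have := μ.measurePreserving_homeomorphUnitSphereProd.lintegral_comp_emb
      (Homeomorph.measurableEmbedding _) (fun p => F p.2)
    simpa using this
  have h4 : ∫⁻ x, F x.2 ∂μ.toSphere.prod (.volumeIoiPow (Module.finrank ℝ E - 1)) =
      μ.toSphere univ * ∫⁻ r in Ioo (0 : ℝ) 1, ENNReal.ofReal (r ^ (n - 1)) * f r := by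
    rw [lintegral_prod _ (by fun_prop)]
    simp only [lintegral_const]
    rw [mul_comm]
    congr 1
    rw [Measure.volumeIoiPow, lintegral_withDensity_eq_lintegral_mul _ (by fun_prop) (by fun_prop),
      hdim]
    simp only [Pi.mul_apply]
    rw [lintegral_subtype_comap measurableSet_Ioi
      (fun r : ℝ => ENNReal.ofReal (r ^ (n - 1)) * F r), ← lintegral_indicator measurableSet_Ioi,
      ← lintegral_indicator measurableSet_Ioo]
    refine lintegral_congr fun r => ?_
    by_cases h0 : 0 < r <;> by_cases h1 : r < 1 <;> simp [hF, indicator, h0, h1]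
  rw [h1, h2, h3, h4, lintegral_Ioo_zero_one_eq]
  congr 1
  refine lintegral_congr fun t => ?_
  rw [← mul_assoc, ← ENNReal.ofReal_mul (Real.exp_pos _).le, ← pow_succ',
    Nat.sub_add_cancel hn, ← Real.exp_nat_mul]
  congr 3
  ring

/-! ### Critical constants and comparison of the two weights -/

theorem sphereArea_pos {n : ℕ} (hn : 1 ≤ n) : 0 < sphereArea n := by
  have : Nonempty (Fin n) := ⟨⟨0, hn⟩⟩
  refine ENNReal.toReal_pos ?_ (measure_ne_top _ _)
  rw [Ne, Measure.measure_univ_eq_zero]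
  exact Measure.toSphere_ne_zero _

theorem cConst_pos {k : ℕ} (hk : 1 ≤ k) : 0 < cConst (2 * k) k := by
  have h1 := sphereArea_pos (n := 2 * k) (by omega)
  have h2 : 0 < (2 * k - 1).choose (k - 1) := Nat.choose_pos (by omega)
  have h3 : (0 : ℝ) < k := by exact_mod_cast hk
  have h4 : (0 : ℝ) < ((2 * k - 1).choose (k - 1) : ℝ) := by exact_mod_cast h2
  unfold cConst
  positivity

theorem gammaCrit_eq {k : ℕ} (β : ℝ) :
    gammaCrit (2 * k) β = ((k : ℝ) + 1) / (k * (1 - β)) := by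
  unfold gammaCrit
  push_cast
  rw [show (2 * (k : ℝ) + 2) = 2 * (k + 1) by ring, mul_assoc,
    mul_div_mul_left _ _ (by norm_num)]

theorem gammaCrit_pos {k : ℕ} (hk : 1 ≤ k) {β : ℝ} (hβ : β < 1) : 0 < gammaCrit (2 * k) β := by
  have h3 : (0 : ℝ) < k := by exact_mod_cast hk
  have : 0 < 1 - β := by linarith
  rw [gammaCrit_eq]
  positivity

theorem alphaCrit_eq {k : ℕ} (β : ℝ) :
    alphaCrit (2 * k) k β =
      (2 * k) * (cConst (2 * k) k ^ (1 / (k : ℝ)) * (1 - β)) ^ (1 / (1 - β)) := by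
  unfold alphaCrit
  push_cast
  congr 4
  rw [← div_div, div_self (by norm_num)]

theorem alphaCrit_pos {k : ℕ} (hk : 1 ≤ k) {β : ℝ} (hβ : β < 1) :
    0 < alphaCrit (2 * k) k β := by
  have h3 : (0 : ℝ) < k := by exact_mod_cast hk
  have : 0 < 1 - β := by linarith
  have := cConst_pos hk
  rw [alphaCrit_eq]
  positivity

/-- Displays α_{n,β} as n A^γ, with A the factor that normalizes |v| in Moser's inequality. -/
theorem alphaCrit_eq_rpow {k : ℕ} (hk : 1 ≤ k) {β : ℝ} (hβ : β < 1) :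
    alphaCrit (2 * k) k β = (2 * k) *
      (cConst (2 * k) k ^ (1 / ((k : ℝ) + 1)) * (1 - β) ^ ((k : ℝ) / (k + 1))) ^
        gammaCrit (2 * k) β := by
  have h3 : (0 : ℝ) < k := by exact_mod_cast hk
  have hθ : 0 < 1 - β := by linarith
  have hc := cConst_pos hk
  rw [alphaCrit_eq, gammaCrit_eq, Real.mul_rpow (by positivity) hθ.le,
    Real.mul_rpow (by positivity) (by positivity), ← Real.rpow_mul hc.le, ← Real.rpow_mul hc.le,
    ← Real.rpow_mul hθ.le]
  congr 3 <;> field_simp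

theorem logWeightZero_le_logWeightOne {n : ℕ} {β r : ℝ} (hβ : 0 ≤ β) (h0 : 0 < r) (h1 : r < 1) :
    logWeightZero n β r ≤ logWeightOne n β r := by
  unfold logWeightZero logWeightOne
  refine Real.rpow_le_rpow (log_one_div_pos h0 h1).le ?_ (by positivity)
  refine Real.log_le_log (by positivity) ?_
  gcongr
  exact Real.one_le_exp zero_le_one

theorem weightedNorm_mono_weight {n k : ℕ} {w w' : ℝ → ℝ} (u : EuclideanSpace ℝ (Fin n) → ℝ)
    (h : ∀ r ∈ Ioo (0 : ℝ) 1, w r ≤ w' r) : weightedNorm k w u ≤ weightedNorm k w' u := by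
  unfold weightedNorm
  refine ENNReal.rpow_le_rpow ?_ (by positivity)
  gcongr 1
  refine setLIntegral_mono' measurableSet_Ioo fun r hr => ENNReal.ofReal_le_ofReal ?_
  refine mul_le_mul_of_nonneg_left (h r hr) ?_
  have := hr.1
  positivity

theorem weightedNorm_logWeightZero {k : ℕ} (β : ℝ) (u : EuclideanSpace ℝ (Fin (2 * k)) → ℝ) :
    weightedNorm k (logWeightZero (2 * k) β) u =
      (ENNReal.ofReal (cConst (2 * k) k) * totalEnergy k β (profile u)) ^
        (1 / ((k : ℝ) + 1)) := by
  unfold weightedNorm totalEnergy energyDensity logWeightZero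
  have e1 : 2 * k - k = k := by omega
  have e2 : β * ((2 * k : ℕ) : ℝ) / 2 = β * k := by push_cast; ring
  rw [e1, e2]

/-- As w₀ is the smaller weight, control of either norm controls the energy taken with w₀. -/
theorem totalEnergy_bounds {k : ℕ} (hk : 1 ≤ k) {β : ℝ} (hβ : 0 ≤ β) {w : ℝ → ℝ}
    (hw : w = logWeightZero (2 * k) β ∨ w = logWeightOne (2 * k) β)
    (u : EuclideanSpace ℝ (Fin (2 * k)) → ℝ) :
    (weightedNorm k w u < ⊤ → totalEnergy k β (profile u) < ⊤) ∧
    (weightedNorm k w u ≤ 1 →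
      ENNReal.ofReal (cConst (2 * k) k) * totalEnergy k β (profile u) ≤ 1) := by
  have hle : weightedNorm k (logWeightZero (2 * k) β) u ≤ weightedNorm k w u := by
    rcases hw with rfl | rfl
    · exact le_rfl
    · exact weightedNorm_mono_weight u fun r hr => logWeightZero_le_logWeightOne hβ hr.1 hr.2
  have hp : (0 : ℝ) < 1 / ((k : ℝ) + 1) := by positivity
  rw [weightedNorm_logWeightZero] at hle
  constructor
  · intro h
    have h1 := hle.trans_lt h
    rw [ENNReal.rpow_lt_top_iff_of_pos hp] at h1
    by_contra h2
    rw [not_lt, top_le_iff] at h2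
    rw [h2, ENNReal.mul_top (by simpa using cConst_pos hk)] at h1
    exact absurd h1 (lt_irrefl _)
  · intro h
    have h1 := hle.trans h
    rwa [← ENNReal.one_rpow (1 / ((k : ℝ) + 1)), ENNReal.rpow_le_rpow_iff hp] at h1

theorem norm_toLp_single_zero {n : ℕ} (hn : 1 ≤ n) (r : ℝ) :
    ‖(WithLp.toLp 2 fun i : Fin n => if (i : ℕ) = 0 then r else 0 :
      EuclideanSpace ℝ (Fin n))‖ = |r| := by
  have : (WithLp.toLp 2 fun i : Fin n => if (i : ℕ) = 0 then r else 0 :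
      EuclideanSpace ℝ (Fin n)) = EuclideanSpace.single (⟨0, hn⟩ : Fin n) r := by
    ext i
    simp [Fin.ext_iff]
  rw [this, PiLp.norm_single, Real.norm_eq_abs]

theorem IsRadial.eq_profile {n : ℕ} (hn : 1 ≤ n) {u : EuclideanSpace ℝ (Fin n) → ℝ}
    (hu : IsRadial u) {x : EuclideanSpace ℝ (Fin n)} (hx : ‖x‖ < 1) : u x = profile u ‖x‖ := by
  have h := norm_toLp_single_zero hn ‖x‖
  rw [abs_norm] at h
  refine hu x (by simpa using hx) _ ?_ h.symm
  rw [Metric.mem_ball, dist_zero_right, h]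
  exact hx

theorem continuousOn_Ioo_of_absolutelyContinuous {v : ℝ → ℝ}
    (hac : ∀ a b : ℝ, 0 < a → a < b → b < 1 → AbsolutelyContinuousOnInterval v a b) :
    ContinuousOn v (Ioo 0 1) := by
  intro r hr
  have h1 : 0 < r / 2 := by linarith [hr.1]
  have h2 : r / 2 < (r + 1) / 2 := by linarith [hr.1]
  have h3 : (r + 1) / 2 < 1 := by linarith [hr.2]
  have hc := (hac _ _ h1 h2 h3).continuousOn
  rw [uIcc_of_le h2.le] at hc
  exact (hc.continuousAt (Icc_mem_nhds (by linarith [hr.1]) (by linarith [hr.2]))).continuousWithinAt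

theorem expIntegral_eq {n : ℕ} (hn : 1 ≤ n) (α γ : ℝ) {u : EuclideanSpace ℝ (Fin n) → ℝ}
    (hu : IsRadial u)
    (hac : ∀ a b : ℝ, 0 < a → a < b → b < 1 → AbsolutelyContinuousOnInterval (profile u) a b) :
    expIntegral α γ u = (volume : Measure (EuclideanSpace ℝ (Fin n))).toSphere univ *
      ∫⁻ t in Ioi (0 : ℝ), ENNReal.ofReal
        (Real.exp (α * |profile u (Real.exp (-t))| ^ γ - n * t)) := by
  have : Nonempty (Fin n) := ⟨⟨0, hn⟩⟩
  classical
  -- The profile is known to be measurable only on (0, 1), where it is continuous, so it is cut off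
  -- elsewhere; the origin is a null set.
  set v : ℝ → ℝ := (Ioo (0 : ℝ) 1).piecewise (profile u) (fun _ => 0) with hv
  have hvm : Measurable v := (continuousOn_Ioo_of_absolutelyContinuous hac).measurable_piecewise
    continuousOn_const measurableSet_Ioo
  have hpol := lintegral_ball_norm_eq hn
    (f := fun r => ENNReal.ofReal (Real.exp (α * |v r| ^ γ))) (by fun_prop)
  have h1 : expIntegral α γ u = ∫⁻ x in Metric.ball (0 : EuclideanSpace ℝ (Fin n)) 1,
      ENNReal.ofReal (Real.exp (α * |v ‖x‖| ^ γ)) := by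
    unfold expIntegral
    refine lintegral_congr_ae ?_
    have hne : ∀ᵐ x : EuclideanSpace ℝ (Fin n) ∂(volume.restrict (Metric.ball 0 1)), x ≠ 0 :=
      ae_restrict_of_ae (by simp [ae_iff])
    filter_upwards [hne, ae_restrict_mem measurableSet_ball] with x hx hxb
    have hxb' : ‖x‖ < 1 := by simpa using hxb
    have hmem : ‖x‖ ∈ Ioo (0 : ℝ) 1 := ⟨norm_pos_iff.2 hx, hxb'⟩
    rw [hu.eq_profile hn hxb', hv, piecewise_eq_of_mem _ _ _ hmem]
  rw [h1, hpol]
  congr 1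
  refine setLIntegral_congr_fun measurableSet_Ioi fun t ht => ?_
  have ht' : 0 < t := ht
  have hmem : Real.exp (-t) ∈ Ioo (0 : ℝ) 1 :=
    ⟨Real.exp_pos _, Real.exp_lt_one_iff.2 (by linarith)⟩
  rw [hv, piecewise_eq_of_mem _ _ _ hmem,
    ← ENNReal.ofReal_mul (Real.exp_pos _).le, ← Real.exp_add]
  congr 2
  ring

/-! ### Finiteness and the uniform exponential bound -/

/-- A profile of finite energy grows more slowly than the extremal rate. -/
theorem exists_abs_le_const_add {k : ℕ} (hk : 1 ≤ k) {β : ℝ} (hβ : β < 1) {v : ℝ → ℝ}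
    (hac : ∀ a b : ℝ, 0 < a → a < b → b < 1 → AbsolutelyContinuousOnInterval v a b)
    (hlim : Tendsto v (𝓝[<] 1) (𝓝 0)) (hE : totalEnergy k β v < ⊤) {ε : ℝ} (hε : 0 < ε) :
    ∃ C, 0 ≤ C ∧ ∀ t, 0 < t → |v (Real.exp (-t))| ≤
      C + ε * (t ^ (1 - β)) ^ ((k : ℝ) / (k + 1)) := by
  have hθ : 0 < 1 - β := by linarith
  set P : ℝ := (k : ℝ) / (k + 1) with hP
  have hP0 : 0 ≤ P := by positivity
  set ε' : ℝ := ε * (1 - β) ^ P with hε'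
  have hε'0 : 0 < ε' := by positivity
  have hbdd : BddAbove (range (outerEnergy k β v)) :=
    ⟨_, by rintro _ ⟨t, rfl⟩; exact outerEnergy_le hE t⟩
  -- Beyond t₀ at most ε'^(k+1) of the energy remains; the maximum with 1 only makes the threshold
  -- positive.
  obtain ⟨t₀, ht₀⟩ := exists_lt_of_lt_ciSup
    (sub_lt_self (⨆ t, outerEnergy k β v t) (pow_pos hε'0 (k + 1)))
  set t₁ := max t₀ 1
  have ht₁ : 0 < t₁ := lt_of_lt_of_le one_pos (le_max_right _ _)
  have htail : ∀ t, outerEnergy k β v t - outerEnergy k β v t₁ ≤ ε' ^ (k + 1) := fun t => by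
    have h1 := le_ciSup hbdd t
    have h2 : outerEnergy k β v t₀ ≤ outerEnergy k β v t₁ := outerEnergy_mono hE (le_max_left _ _)
    linarith
  set C₁ := (totalEnergy k β v).toReal ^ (1 / ((k : ℝ) + 1)) * (t₁ ^ (1 - β) / (1 - β)) ^ P
  have hC₁ : 0 ≤ C₁ := by positivity
  refine ⟨|v (Real.exp (-t₁))| + C₁, by positivity, fun t ht => ?_⟩
  have hlast : 0 ≤ ε * (t ^ (1 - β)) ^ P := by positivity
  rcases le_total t t₁ with h | h
  · have h1 := abs_le_outerEnergy hk hβ hac hlim hE ht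
    have h2 : outerEnergy k β v t ^ (1 / ((k : ℝ) + 1)) * (t ^ (1 - β) / (1 - β)) ^ P ≤ C₁ := by
      have := outerEnergy_nonneg (k := k) (β := β) (v := v) t
      have := outerEnergy_le hE t
      simp only [C₁]
      gcongr
    have := abs_nonneg (v (Real.exp (-t₁)))
    linarith
  · have h1 := abs_le_add_outerEnergy hk hβ hac hE ht₁ h
    have h3 : t₁ ^ (1 - β) ≤ t ^ (1 - β) := Real.rpow_le_rpow ht₁.le h hθ.le
    have h4 : (outerEnergy k β v t - outerEnergy k β v t₁) ^ (1 / ((k : ℝ) + 1)) *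
        ((t ^ (1 - β) - t₁ ^ (1 - β)) / (1 - β)) ^ P ≤ ε' * (t ^ (1 - β) / (1 - β)) ^ P := by
      refine mul_le_mul ?_ ?_
        (Real.rpow_nonneg (div_nonneg (sub_nonneg.2 h3) hθ.le) _) hε'0.le
      · refine (Real.rpow_le_rpow (sub_nonneg.2 (outerEnergy_mono hE h)) (htail t)
          (by positivity)).trans_eq ?_
        rw [← Real.rpow_natCast, ← Real.rpow_mul hε'0.le]
        push_cast
        rw [mul_one_div_cancel (by positivity), Real.rpow_one]
      · refine Real.rpow_le_rpow (div_nonneg (sub_nonneg.2 h3) hθ.le) ?_ hP0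
        have : 0 ≤ t₁ ^ (1 - β) := by positivity
        gcongr
        linarith
    have h5 : ε' * (t ^ (1 - β) / (1 - β)) ^ P = ε * (t ^ (1 - β)) ^ P := by
      rw [hε', Real.div_rpow (by positivity) hθ.le]
      have : 0 < (1 - β) ^ P := by positivity
      field_simp
    linarith

theorem expIntegral_lt_top {k : ℕ} (hk : 1 ≤ k) {β : ℝ} (hβ : β < 1)
    {u : EuclideanSpace ℝ (Fin (2 * k)) → ℝ} (hu : IsRadial u)
    (hac : ∀ a b : ℝ, 0 < a → a < b → b < 1 → AbsolutelyContinuousOnInterval (profile u) a b)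
    (hlim : Tendsto (profile u) (𝓝[<] 1) (𝓝 0)) (hE : totalEnergy k β (profile u) < ⊤)
    {γ : ℝ} (h0 : 0 ≤ γ) (hγ : γ ≤ gammaCrit (2 * k) β) : expIntegral 1 γ u < ⊤ := by
  have hk0 : (0 : ℝ) < k := by exact_mod_cast hk
  have hk1 : (1 : ℝ) ≤ k := by exact_mod_cast hk
  have hθ : 0 < 1 - β := by linarith
  have hγc := gammaCrit_pos hk hβ
  set g := gammaCrit (2 * k) β with hg
  -- Chosen so that twice the growing term, raised to the critical power, is t/2, safely below nt.
  set ε : ℝ := (1 / 2) ^ (1 / g) / 2 with hε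
  have hε0 : 0 < ε := by positivity
  obtain ⟨C, hC0, hC⟩ := exists_abs_le_const_add hk hβ hac hlim hE hε0
  rw [expIntegral_eq (by omega) 1 γ hu hac]
  refine ENNReal.mul_lt_top (measure_lt_top _ _) ?_
  have hpt : ∀ t ∈ Ioi (0 : ℝ), ENNReal.ofReal
      (Real.exp (1 * |profile u (Real.exp (-t))| ^ γ - (2 * k : ℕ) * t)) ≤
      ENNReal.ofReal (Real.exp (1 + (2 * C) ^ g) * Real.exp (-1 * t)) := by
    intro t ht
    have ht0 : 0 < t := ht
    rw [← Real.exp_add]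
    refine ENNReal.ofReal_le_ofReal (Real.exp_le_exp.2 ?_)
    set y := |profile u (Real.exp (-t))| with hy
    have hy0 : 0 ≤ y := abs_nonneg _
    have h1 : y ^ γ ≤ 1 + y ^ g := by
      rcases le_total y 1 with h | h
      · have := Real.rpow_le_one hy0 h h0
        have := Real.rpow_nonneg hy0 g
        linarith
      · have := Real.rpow_le_rpow_of_exponent_le h hγ
        linarith
    have h2 : y ^ g ≤ (2 * C) ^ g + t / 2 := by
      set z := ε * (t ^ (1 - β)) ^ ((k : ℝ) / (k + 1)) with hz
      have hz0 : 0 ≤ z := by positivity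
      have hzg : (2 * z) ^ g = t / 2 := by
        have e1 : 2 * z = (1 / 2) ^ (1 / g) * (t ^ (1 - β)) ^ ((k : ℝ) / (k + 1)) := by
          rw [hz, hε]; ring
        rw [e1, Real.mul_rpow (by positivity) (by positivity), ← Real.rpow_mul (by norm_num),
          ← Real.rpow_mul ht0.le, ← Real.rpow_mul ht0.le, one_div_mul_cancel hγc.ne',
          Real.rpow_one]
        have : (1 - β) * ((k : ℝ) / (k + 1)) * g = 1 := by
          rw [hg, gammaCrit_eq]; field_simp
        rw [this, Real.rpow_one]
        ring
      have hyz : y ≤ C + z := hC t ht0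
      have n1 : 0 ≤ (2 * C) ^ g := by positivity
      have n2 : 0 ≤ (2 * z) ^ g := by positivity
      rw [← hzg]
      rcases le_total C z with h | h
      · have := Real.rpow_le_rpow hy0 (by linarith : y ≤ 2 * z) hγc.le
        linarith
      · have := Real.rpow_le_rpow hy0 (by linarith : y ≤ 2 * C) hγc.le
        linarith
    push_cast
    nlinarith
  refine (setLIntegral_mono' measurableSet_Ioi hpt).trans_lt ?_
  have hint : IntegrableOn (fun t : ℝ => Real.exp (1 + (2 * C) ^ g) * Real.exp (-1 * t)) (Ioi 0) :=
    (exp_neg_integrableOn_Ioi 0 one_pos).const_mul _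
  exact hint.lintegral_lt_top

theorem exists_expIntegral_bound {k : ℕ} (hk : 1 ≤ k) {β : ℝ} (hβ0 : 0 ≤ β) (hβ : β < 1) :
    ∃ C : ENNReal, C < ⊤ ∧ ∀ u : EuclideanSpace ℝ (Fin (2 * k)) → ℝ, IsRadial u →
      (∀ a b : ℝ, 0 < a → a < b → b < 1 → AbsolutelyContinuousOnInterval (profile u) a b) →
      Tendsto (profile u) (𝓝[<] 1) (𝓝 0) →
      ENNReal.ofReal (cConst (2 * k) k) * totalEnergy k β (profile u) ≤ 1 →
      expIntegral (alphaCrit (2 * k) k β) (gammaCrit (2 * k) β) u ≤ C := by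
  have hk0 : (0 : ℝ) < k := by exact_mod_cast hk
  have hk1 : (1 : ℝ) ≤ k := by exact_mod_cast hk
  have hθ : 0 < 1 - β := by linarith
  have hc := cConst_pos hk
  obtain ⟨C, hC, hbound⟩ := exists_moser_bound hk hθ (by linarith)
  refine ⟨_, ENNReal.mul_lt_top (measure_lt_top
    (volume : Measure (EuclideanSpace ℝ (Fin (2 * k)))).toSphere univ) hC, ?_⟩
  intro u hu hac hlim hE1
  set c := cConst (2 * k) k with hcdef
  set v := profile u with hv
  have hE : totalEnergy k β v < ⊤ := by
    by_contra h2
    rw [not_lt, top_le_iff] at h2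
    rw [h2, ENNReal.mul_top (by simpa using hc)] at hE1
    exact absurd hE1 (by simp)
  have hcE : c * (totalEnergy k β v).toReal ≤ 1 := by
    have := ENNReal.toReal_mono ENNReal.one_ne_top hE1
    rwa [ENNReal.toReal_mul, ENNReal.toReal_ofReal hc.le, ENNReal.toReal_one] at this
  set P : ℝ := (k : ℝ) / (k + 1) with hP
  have hP0 : 0 ≤ P := by positivity
  set A : ℝ := c ^ (1 / ((k : ℝ) + 1)) * (1 - β) ^ P with hA
  have hA0 : 0 < A := by positivity
  rw [expIntegral_eq (by omega) _ _ hu hac]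
  gcongr
  have hscale : ∀ e x : ℝ, 0 ≤ e → 0 ≤ x → A * (e ^ (1 / ((k : ℝ) + 1)) * (x / (1 - β)) ^ P) =
      (c * e) ^ (1 / ((k : ℝ) + 1)) * x ^ P := by
    intro e x he hx
    rw [hA, Real.mul_rpow hc.le he, Real.div_rpow hx hθ.le]
    have : 0 < (1 - β) ^ P := by positivity
    field_simp
  -- N = 2k is the dimension: it multiplies both φ^γ, through α_{n,β} = 2k A^γ, and t, through the
  -- volume element.
  have key := hbound (2 * k) (by linarith) (fun t => A * |v (Real.exp (-t))|)
    (fun t => c * outerEnergy k β v t) (fun t => by positivity)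
    (fun t => mul_nonneg hc.le (outerEnergy_nonneg t))
    (fun t => (mul_le_mul_of_nonneg_left (outerEnergy_le hE t) hc.le).trans hcE)
    (fun t ht => by
      rw [← hscale _ _ (outerEnergy_nonneg t) (by positivity)]
      exact mul_le_mul_of_nonneg_left (abs_le_outerEnergy hk hβ hac hlim hE ht) hA0.le)
    (fun s t hs hst => by
      rw [← mul_sub, ← hscale _ _ (sub_nonneg.2 (outerEnergy_mono hE hst))
        (sub_nonneg.2 (Real.rpow_le_rpow hs.le hst hθ.le)), ← mul_add]
      exact mul_le_mul_of_nonneg_left (abs_le_add_outerEnergy hk hβ hac hE hs hst) hA0.le)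
    (fun s t _ hst => mul_le_mul_of_nonneg_left (outerEnergy_mono hE hst) hc.le)
  refine le_of_eq_of_le ?_ key
  refine lintegral_congr fun t => ?_
  rw [← gammaCrit_eq, alphaCrit_eq_rpow hk hβ, Real.mul_rpow hA0.le (abs_nonneg _)]
  congr 2
  push_cast
  ring

/-! ### Hessian operators of radial functions -/

theorem card_filter_mem_powersetCard {n j : ℕ} (hj : 1 ≤ j) (i : Fin n) :
    (((Finset.univ : Finset (Fin n)).powersetCard j).filter (fun s => i ∈ s)).card =
      (n - 1).choose (j - 1) := by
  have hn : 1 ≤ n := by have := i.pos; omega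
  have h1 := Finset.card_filter_add_card_filter_not
    (s := (Finset.univ : Finset (Fin n)).powersetCard j) (fun s => i ∈ s)
  have h2 : ((Finset.univ : Finset (Fin n)).powersetCard j).filter (fun s => i ∉ s) =
      (Finset.univ.erase i).powersetCard j := by
    ext s
    simp only [Finset.mem_filter, Finset.mem_powersetCard, Finset.subset_erase]
    tauto
  rw [h2, Finset.card_powersetCard, Finset.card_powersetCard, Finset.card_erase_of_mem
    (Finset.mem_univ i), Finset.card_univ, Fintype.card_fin] at h1
  obtain ⟨n, rfl⟩ := Nat.exists_eq_add_of_le' hn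
  obtain ⟨j, rfl⟩ := Nat.exists_eq_add_of_le' hj
  rw [Nat.choose_succ_succ'] at h1
  simp only [Nat.add_sub_cancel] at h1 ⊢
  omega

/-- The matrix determinant lemma for a rank-one perturbation, after factoring out a. -/
theorem det_smul_one_add_smul_vecMulVec {m : Type*} [Fintype m] [DecidableEq m] [Nonempty m]
    {a : ℝ} (ha : a ≠ 0) (b : ℝ) (x : m → ℝ) :
    (a • (1 : Matrix m m ℝ) + b • Matrix.vecMulVec x x).det =
      a ^ (Fintype.card m - 1) * (a + b * ∑ i, x i ^ 2) := by
  have h1 : a • (1 : Matrix m m ℝ) + b • Matrix.vecMulVec x x =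
      a • (1 + Matrix.replicateCol Unit ((b / a) • x) * Matrix.replicateRow Unit x) := by
    ext i j
    simp only [Matrix.add_apply, Matrix.smul_apply, Matrix.vecMulVec_apply, Matrix.mul_apply,
      smul_eq_mul, Matrix.replicateCol_apply, Matrix.replicateRow_apply, Pi.smul_apply,
      Finset.univ_unique, Finset.sum_singleton]
    field_simp
  rw [h1, Matrix.det_smul, Matrix.det_one_add_replicateCol_mul_replicateRow]
  have hcard : Fintype.card m = Fintype.card m - 1 + 1 :=
    (Nat.sub_add_cancel Fintype.card_pos).symm
  rw [hcard, pow_succ, Nat.add_sub_cancel, mul_assoc]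
  congr 1
  have h2 : x ⬝ᵥ (b / a) • x = b / a * ∑ i, x i ^ 2 := by
    simp [dotProduct, Finset.mul_sum]
    exact Finset.sum_congr rfl fun i _ => by ring
  rw [h2]
  field_simp

/-- The elementary symmetric functions of `a I + b x xᵀ`. -/
theorem principalMinorSum_smul_one_add {n j : ℕ} (hj : 1 ≤ j) {a : ℝ} (ha : a ≠ 0) (b : ℝ)
    (x : Fin n → ℝ) :
    principalMinorSum j (a • (1 : Matrix (Fin n) (Fin n) ℝ) + b • Matrix.vecMulVec x x) =
      a ^ (j - 1) * (n.choose j * a + b * (((n - 1).choose (j - 1)) * ∑ i, x i ^ 2)) := by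
  unfold principalMinorSum
  have h1 : ∀ s ∈ (Finset.univ : Finset (Fin n)).powersetCard j,
      ((a • (1 : Matrix (Fin n) (Fin n) ℝ) + b • Matrix.vecMulVec x x).submatrix
        (fun i : s => (i : Fin n)) (fun i : s => (i : Fin n))).det =
      a ^ (j - 1) * (a + b * ∑ i, if i ∈ s then x i ^ 2 else 0) := by
    intro s hs
    have hcard := (Finset.mem_powersetCard.1 hs).2
    have hne : Nonempty s := by
      have : s.Nonempty := by rw [← Finset.card_pos]; omega
      exact this.to_subtype
    have e : (a • (1 : Matrix (Fin n) (Fin n) ℝ) + b • Matrix.vecMulVec x x).submatrix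
        (fun i : s => (i : Fin n)) (fun i : s => (i : Fin n)) =
        a • (1 : Matrix s s ℝ) + b • Matrix.vecMulVec (fun i : s => x i) (fun i : s => x i) := by
      ext i j
      simp [Matrix.one_apply, Matrix.vecMulVec_apply]
    rw [e, det_smul_one_add_smul_vecMulVec ha, Fintype.card_coe, hcard]
    congr 3
    rw [Finset.sum_coe_sort s (fun i => x i ^ 2), ← Finset.sum_filter,
      Finset.filter_mem_eq_inter, Finset.univ_inter]
  rw [Finset.sum_congr rfl h1, ← Finset.mul_sum, Finset.sum_add_distrib, ← Finset.mul_sum,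
    Finset.sum_comm, Finset.sum_const, Finset.card_powersetCard, Finset.card_univ,
    Fintype.card_fin, nsmul_eq_mul]
  congr 3
  rw [Finset.mul_sum]
  refine Finset.sum_congr rfl fun i _ => ?_
  rw [← Finset.sum_filter, Finset.sum_const, card_filter_mem_powersetCard hj, nsmul_eq_mul]

/-- The ratio of binom(2k, j) to binom(2k-1, j-1) is 2k/j ≥ 2 for j ≤ k, so a single inequality
settles all the operators S_1, …, S_k. -/
theorem principalMinorSum_smul_one_add_nonneg {k j : ℕ} (hj : 1 ≤ j) (hjk : j ≤ k) {a b : ℝ}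
    (ha : 0 < a) (x : Fin (2 * k) → ℝ) (h : 0 ≤ 2 * a + b * ∑ i, x i ^ 2) :
    0 ≤ principalMinorSum j
      (a • (1 : Matrix (Fin (2 * k)) (Fin (2 * k)) ℝ) + b • Matrix.vecMulVec x x) := by
  rw [principalMinorSum_smul_one_add hj ha.ne']
  refine mul_nonneg (by positivity) ?_
  have hc : 2 * (2 * k - 1).choose (j - 1) ≤ (2 * k).choose j := by
    obtain ⟨j, rfl⟩ := Nat.exists_eq_add_of_le' hj
    obtain ⟨m, hm⟩ := Nat.exists_eq_add_of_le' (show 1 ≤ 2 * k by omega)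
    rw [hm]
    simp only [Nat.add_sub_cancel]
    have h3 := Nat.add_one_mul_choose_eq m j
    have h4 : 2 * (j + 1) ≤ m + 1 := by omega
    refine Nat.le_of_mul_le_mul_right (c := j + 1) ?_ (by omega)
    rw [← h3]
    calc 2 * m.choose j * (j + 1) = 2 * (j + 1) * m.choose j := by ring
      _ ≤ _ := Nat.mul_le_mul_right _ h4
  have hc' : 2 * ((2 * k - 1).choose (j - 1) : ℝ) ≤ ((2 * k).choose j : ℝ) := by exact_mod_cast hc
  have hn : (0 : ℝ) ≤ ((2 * k - 1).choose (j - 1) : ℝ) := by positivity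
  nlinarith [mul_nonneg hn h, mul_le_mul_of_nonneg_right hc' ha.le]

/-- The Hessian of `x ↦ h (|x|²)`. -/
theorem hessianMatrix_comp_norm_sq {n : ℕ} {h h' : ℝ → ℝ} {h'' a : ℝ}
    {x : EuclideanSpace ℝ (Fin n)} (ha : a < ‖x‖ ^ 2) (hx : ‖x‖ < 1)
    (h1 : ∀ s ∈ Ioo a 1, HasDerivAt h (h' s) s) (h2 : HasDerivAt h' h'' (‖x‖ ^ 2)) :
    hessianMatrix (fun y : EuclideanSpace ℝ (Fin n) => h (‖y‖ ^ 2)) x =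
      (2 * h' (‖x‖ ^ 2)) • (1 : Matrix (Fin n) (Fin n) ℝ) + (4 * h'') • Matrix.vecMulVec x x := by
  have hns : ∀ y : EuclideanSpace ℝ (Fin n),
      HasFDerivAt (fun z : EuclideanSpace ℝ (Fin n) => ‖z‖ ^ 2) ((2 : ℝ) • innerSL ℝ y) y :=
    fun y => (hasStrictFDerivAt_norm_sq y).hasFDerivAt.congr_fderiv (by ext; simp)
  have hx2 : ‖x‖ ^ 2 < 1 := by nlinarith [norm_nonneg x]
  have hd : ∀ y : EuclideanSpace ℝ (Fin n), ‖y‖ ^ 2 ∈ Ioo a 1 →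
      fderiv ℝ (fun y : EuclideanSpace ℝ (Fin n) => h (‖y‖ ^ 2)) y =
        h' (‖y‖ ^ 2) • (2 : ℝ) • innerSL ℝ y :=
    fun y hy => ((h1 _ hy).comp_hasFDerivAt y (hns y)).fderiv
  have hev : fderiv ℝ (fun y : EuclideanSpace ℝ (Fin n) => h (‖y‖ ^ 2)) =ᶠ[𝓝 x]
      fun y => h' (‖y‖ ^ 2) • (2 : ℝ) • innerSL ℝ y := by
    have : ∀ᶠ y in 𝓝 x, ‖y‖ ^ 2 ∈ Ioo a 1 :=
      (continuous_norm.pow 2).continuousAt.eventually_mem (Ioo_mem_nhds ha hx2)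
    filter_upwards [this] with y hy using hd y hy
  let B : EuclideanSpace ℝ (Fin n) →L[ℝ] EuclideanSpace ℝ (Fin n) →L[ℝ] ℝ := innerSL ℝ
  have hB : ∀ v w, B v w = inner ℝ v w := fun _ _ => rfl
  have hsecond : HasFDerivAt
      (fun y : EuclideanSpace ℝ (Fin n) => h' (‖y‖ ^ 2) • (2 : ℝ) • B y) _ x :=
    (h2.comp_hasFDerivAt x (hns x)).smul ((B.hasFDerivAt (x := x)).const_smul (2 : ℝ))
  ext i j
  simp only [hessianMatrix, Matrix.of_apply]
  rw [hev.fderiv_eq]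
  change fderiv ℝ (fun y : EuclideanSpace ℝ (Fin n) => h' (‖y‖ ^ 2) • (2 : ℝ) • B y) x _ _ = _
  rw [hsecond.fderiv]
  simp only [Function.comp_apply, add_apply, smul_apply,
    ContinuousLinearMap.smulRight_apply, innerSL_apply_apply, hB, EuclideanSpace.inner_single_right,
    smul_eq_mul, Matrix.add_apply, Matrix.smul_apply, Matrix.one_apply, Matrix.vecMulVec_apply]
  by_cases hij : i = j
  · subst hij; simp; ring
  · simp [hij, Ne.symm hij]; ring

/-! ### Regularized logarithmic potentials -/

/-- Half the logarithm of `(1+ε)/(s+ε)`: a regularization at scale `ε` of `ln (1/|x|)`,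
with `s = |x|²`. -/
def regLog (ε s : ℝ) : ℝ := Real.log ((1 + ε) / (s + ε)) / 2

/-- The function `s ↦ c (1 - (1 + regLog ε s)^δ)`. -/
def logProfile (δ c ε s : ℝ) : ℝ := c * (1 - (1 + regLog ε s) ^ δ)

/-- The derivative of `logProfile`. -/
def logProfileDeriv (δ c ε s : ℝ) : ℝ := c * δ / 2 * ((1 + regLog ε s) ^ (δ - 1) / (s + ε))

/-- The radial function with profile `r ↦ c (1 - (1 + regLog ε (r^2))^δ)`. -/
def logPotential {n : ℕ} (δ c ε : ℝ) (x : EuclideanSpace ℝ (Fin n)) : ℝ :=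
  logProfile δ c ε (‖x‖ ^ 2)

theorem regLog_nonneg {ε s : ℝ} (hs : 0 < s + ε) (h1 : s ≤ 1) : 0 ≤ regLog ε s := by
  refine div_nonneg (Real.log_nonneg ?_) (by norm_num)
  rw [le_div_iff₀ hs]
  linarith

theorem hasDerivAt_regLog {ε s : ℝ} (hε : 0 ≤ ε) (hs : 0 < s + ε) :
    HasDerivAt (regLog ε) (-(1 / (2 * (s + ε)))) s := by
  have h1 : (1 + ε) / (s + ε) ≠ 0 := by positivity
  have h2 := ((((hasDerivAt_const s (1 + ε)).div ((hasDerivAt_id s).add_const ε) hs.ne').log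
    h1).div_const 2)
  refine h2.congr_deriv ?_
  simp only [id, zero_mul, mul_one, zero_sub, Pi.div_apply]
  have : 1 + ε ≠ 0 := by positivity
  field_simp

theorem hasDerivAt_logProfile (δ c : ℝ) {ε s : ℝ} (hε : 0 ≤ ε) (hs : 0 < s + ε) (h1 : s ≤ 1) :
    HasDerivAt (logProfile δ c ε) (logProfileDeriv δ c ε s) s := by
  have hτ := regLog_nonneg hs h1
  have h2 := ((((hasDerivAt_regLog hε hs).const_add 1).rpow_const (p := δ)
    (Or.inl (by positivity))).const_sub 1).const_mul c
  refine h2.congr_deriv ?_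
  unfold logProfileDeriv
  field_simp

theorem hasDerivAt_logProfileDeriv (δ c : ℝ) {ε s : ℝ} (hε : 0 ≤ ε) (hs : 0 < s + ε)
    (h1 : s ≤ 1) :
    HasDerivAt (logProfileDeriv δ c ε)
      (c * δ / 2 * ((1 - δ) * (1 + regLog ε s) ^ (δ - 2) / (2 * (s + ε) ^ 2) -
        (1 + regLog ε s) ^ (δ - 1) / (s + ε) ^ 2)) s := by
  have hτ := regLog_nonneg hs h1
  have h2 := ((((hasDerivAt_regLog hε hs).const_add 1).rpow_const (p := δ - 1)
    (Or.inl (by positivity))).div ((hasDerivAt_id s).add_const ε) hs.ne').const_mul (c * δ / 2)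
  refine h2.congr_deriv ?_
  simp only [id]
  rw [show δ - 1 - 1 = δ - 2 by ring]
  field_simp
  ring

theorem contDiffAt_logProfile (δ c : ℝ) {ε s : ℝ} (hε : 0 ≤ ε) (hs : 0 < s + ε) (h1 : s ≤ 1) :
    ContDiffAt ℝ 2 (logProfile δ c ε) s := by
  have hτ := regLog_nonneg hs h1
  have h2 : (1 + ε) / (s + ε) ≠ 0 := by positivity
  have h3 : ContDiffAt ℝ 2 (regLog ε) s :=
    ((contDiffAt_const.div (contDiffAt_id.add contDiffAt_const) hs.ne').log h2).div_const 2
  exact contDiffAt_const.mul (contDiffAt_const.sub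
    ((contDiffAt_const.add h3).rpow_const_of_ne (by positivity)))

theorem isRadial_logPotential {n : ℕ} (δ c ε : ℝ) :
    IsRadial (logPotential δ c ε : EuclideanSpace ℝ (Fin n) → ℝ) := fun x _ y _ h => by
  unfold logPotential
  rw [h]

theorem logProfile_one (δ c : ℝ) {ε : ℝ} (hε : 0 ≤ ε) : logProfile δ c ε 1 = 0 := by
  unfold logProfile regLog
  rw [div_self (by positivity)]
  simp

theorem logPotential_mem_PhiRad {k : ℕ} {δ c ε : ℝ} (hδ0 : 0 < δ) (hδ1 : δ ≤ 1) (hc : 0 < c)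
    (hε : 0 < ε) : (logPotential δ c ε : EuclideanSpace ℝ (Fin (2 * k)) → ℝ) ∈
      PhiRad (2 * k) k := by
  have hnn : ∀ x : EuclideanSpace ℝ (Fin (2 * k)), 0 < ‖x‖ ^ 2 + ε := fun x => by positivity
  have hsq : ∀ x : EuclideanSpace ℝ (Fin (2 * k)), ‖x‖ ≤ 1 → ‖x‖ ^ 2 ≤ 1 := fun x hx =>
    pow_le_one₀ (norm_nonneg x) hx
  have hreg : ∀ x : EuclideanSpace ℝ (Fin (2 * k)), ‖x‖ ≤ 1 →
      ContDiffAt ℝ 2 (logPotential δ c ε) x := fun x hx =>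
    (contDiffAt_logProfile δ c hε.le (hnn x) (hsq x hx)).comp x (contDiff_norm_sq ℝ).contDiffAt
  refine ⟨⟨fun x hx => (hreg x (by simpa using (Metric.mem_ball.1 hx).le)).contDiffWithinAt,
    fun x hx => (hreg x (by simpa using hx)).continuousAt.continuousWithinAt, ?_⟩,
    isRadial_logPotential δ c ε, fun x hx => ?_⟩
  · intro j hj hjk x hx
    have hx1 : ‖x‖ < 1 := by simpa using hx
    have hs := hnn x
    have hs1 := hsq x hx1.le
    have hτ := regLog_nonneg hs hs1
    unfold hessianOp
    have hH := hessianMatrix_comp_norm_sq (h := logProfile δ c ε) (h' := logProfileDeriv δ c ε)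
      -- A negative left endpoint keeps |x|² inside the open interval even at the origin.
      (a := -ε) (by linarith) hx1
      (fun s hs => hasDerivAt_logProfile δ c hε.le (by linarith [hs.1]) hs.2.le)
      (hasDerivAt_logProfileDeriv δ c hε.le hs hs1)
    change 0 ≤ principalMinorSum j (hessianMatrix
      (fun y : EuclideanSpace ℝ (Fin (2 * k)) => logProfile δ c ε (‖y‖ ^ 2)) x)
    rw [hH]
    refine principalMinorSum_smul_one_add_nonneg hj hjk ?_ _ ?_
    · unfold logProfileDeriv; positivity
    · have e : ∑ i, x i ^ 2 = ‖x‖ ^ 2 := by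
        rw [EuclideanSpace.norm_sq_eq]; simp
      rw [e]
      unfold logProfileDeriv
      set s := ‖x‖ ^ 2 with hsdef
      have hs0 : 0 ≤ s := by positivity
      set A := (1 + regLog ε s) ^ (δ - 1)
      set B := (1 + regLog ε s) ^ (δ - 2)
      have hA : 0 ≤ A := by positivity
      have hB : 0 ≤ B := by positivity
      have hd : 0 ≤ 1 - δ := by linarith
      -- The leading terms in A cancel up to Aε, and the remainder carries 1 - δ; this is where δ ≤
      -- 1 gives admissibility.
      have e2 : 2 * (2 * (c * δ / 2 * (A / (s + ε)))) + 4 * (c * δ / 2 *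
          ((1 - δ) * B / (2 * (s + ε) ^ 2) - A / (s + ε) ^ 2)) * s =
          2 * c * δ * (A * ε + (1 - δ) * B * s / 2) / (s + ε) ^ 2 := by
        field_simp
        ring
      rw [e2]
      positivity
  · have : ‖x‖ = 1 := by simpa using hx
    simp only [logPotential, this, one_pow, logProfile_one δ c hε.le]

theorem profile_logPotential {n : ℕ} (hn : 1 ≤ n) (δ c ε r : ℝ) :
    profile (logPotential δ c ε : EuclideanSpace ℝ (Fin n) → ℝ) r = logProfile δ c ε (r ^ 2) := by
  unfold profile logPotential
  rw [norm_toLp_single_zero hn, sq_abs]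

theorem hasDerivAt_logProfile_sq (δ c : ℝ) {ε r : ℝ} (hε : 0 ≤ ε) (hr : 0 < r ^ 2 + ε)
    (h1 : r ^ 2 ≤ 1) :
    HasDerivAt (fun r => logProfile δ c ε (r ^ 2))
      (c * δ * ((1 + regLog ε (r ^ 2)) ^ (δ - 1) * (r / (r ^ 2 + ε)))) r := by
  have h2 := HasDerivAt.comp (h₂ := logProfile δ c ε) (h := fun x : ℝ => x ^ 2) r
    (hasDerivAt_logProfile δ c hε hr h1) (hasDerivAt_pow 2 r)
  refine h2.congr_deriv ?_
  unfold logProfileDeriv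
  simp
  field_simp

theorem deriv_profile_logPotential {n : ℕ} (hn : 1 ≤ n) (δ c : ℝ) {ε r : ℝ} (hε : 0 ≤ ε)
    (h0 : 0 < r) (h1 : r ≤ 1) :
    deriv (profile (logPotential δ c ε : EuclideanSpace ℝ (Fin n) → ℝ)) r =
      c * δ * ((1 + regLog ε (r ^ 2)) ^ (δ - 1) * (r / (r ^ 2 + ε))) := by
  have : profile (logPotential δ c ε : EuclideanSpace ℝ (Fin n) → ℝ) =
      fun r => logProfile δ c ε (r ^ 2) := funext fun r => profile_logPotential hn δ c ε r
  rw [this]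
  exact (hasDerivAt_logProfile_sq δ c hε (by positivity) (pow_le_one₀ h0.le h1)).deriv

/-- The comparison of `ln (1/r)` with its regularization. -/
theorem one_add_log_mul_le {ε r : ℝ} (hε : 0 ≤ ε) (hε1 : ε ≤ 1) (h0 : 0 < r) (h1 : r ≤ 1) :
    (1 + Real.log (1 / r)) * (r ^ 2 / (r ^ 2 + ε)) ≤ 1 + regLog ε (r ^ 2) := by
  have hx : 0 < r ^ 2 := by positivity
  have hx1 : r ^ 2 ≤ 1 := pow_le_one₀ h0.le h1
  have hl : Real.log (1 / r) = -(Real.log (r ^ 2) / 2) := by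
    rw [one_div, Real.log_inv, Real.log_pow]; push_cast; ring
  unfold regLog
  rw [hl]
  set x := r ^ 2
  have hy : 0 < x + ε := by positivity
  rw [Real.log_div (by positivity) hy.ne', mul_div_assoc', div_le_iff₀ hy]
  have hlog1 : 0 ≤ Real.log (1 + ε) := Real.log_nonneg (by linarith)
  have hlogy : Real.log (x + ε) ≤ 1 := by
    have := Real.log_le_sub_one_of_pos hy
    linarith
  -- With L = ln(x + ε), the claim loses at most x(L - ln x)/2 + εL/2, each half being at most ε/2;
  -- the gain ε from the additive 1 pays for both.
  have hquot : x * (Real.log (x + ε) - Real.log x) ≤ ε := by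
    have h2 := Real.log_le_sub_one_of_pos (div_pos hy hx)
    rw [Real.log_div hy.ne' hx.ne'] at h2
    calc _ ≤ x * ((x + ε) / x - 1) := mul_le_mul_of_nonneg_left h2 hx.le
      _ = ε := by field_simp; ring
  nlinarith [mul_nonneg hy.le hlog1, mul_le_mul_of_nonneg_left hlogy hε]

/-- The logarithmic slope of the regularized profile is at most that of the singular one. -/
theorem regLog_rpow_mul_le {δ ε r : ℝ} (hδ0 : 0 ≤ δ) (hδ1 : δ ≤ 1) (hε : 0 ≤ ε) (hε1 : ε ≤ 1)
    (h0 : 0 < r) (h1 : r ≤ 1) :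
    (1 + regLog ε (r ^ 2)) ^ (δ - 1) * (r ^ 2 / (r ^ 2 + ε)) ≤
      (1 + Real.log (1 / r)) ^ (δ - 1) := by
  have hkey := one_add_log_mul_le hε hε1 h0 h1
  have hl : 0 ≤ Real.log (1 / r) := Real.log_nonneg (by rw [one_div]; exact (one_le_inv₀ h0).2 h1)
  set ρ := r ^ 2 / (r ^ 2 + ε)
  have hρ0 : 0 < ρ := by positivity
  have hρ1 : ρ ≤ 1 := by rw [div_le_one (by positivity)]; linarith
  calc (1 + regLog ε (r ^ 2)) ^ (δ - 1) * ρ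
      ≤ ((1 + Real.log (1 / r)) * ρ) ^ (δ - 1) * ρ := by
        refine mul_le_mul_of_nonneg_right ?_ hρ0.le
        exact Real.rpow_le_rpow_of_nonpos (by positivity) hkey (by linarith)
    _ = (1 + Real.log (1 / r)) ^ (δ - 1) * ρ ^ δ := by
        rw [Real.mul_rpow (by positivity) hρ0.le, mul_assoc, ← Real.rpow_add_one hρ0.ne',
          sub_add_cancel]
    _ ≤ _ := mul_le_of_le_one_right (by positivity) (Real.rpow_le_one hρ0.le hρ1 hδ0)

theorem absolutelyContinuous_of_hasDerivAt_bound {v v' : ℝ → ℝ} {a b C : ℝ} (hab : a ≤ b)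
    (hv : ∀ r ∈ Icc a b, HasDerivAt v (v' r) r) (hC : ∀ r ∈ Icc a b, |v' r| ≤ C) :
    AbsolutelyContinuousOnInterval v a b := by
  have hC0 : 0 ≤ C := (abs_nonneg _).trans (hC a (left_mem_Icc.2 hab))
  have hlip : LipschitzOnWith C.toNNReal v (uIcc a b) := by
    rw [uIcc_of_le hab]
    refine (convex_Icc a b).lipschitzOnWith_of_nnnorm_hasDerivWithin_le
      (fun r hr => (hv r hr).hasDerivWithinAt) fun r hr => ?_
    rw [← NNReal.coe_le_coe, coe_nnnorm, Real.coe_toNNReal _ hC0, Real.norm_eq_abs]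
    exact hC r hr
  exact hlip.absolutelyContinuousOnInterval

theorem log_exp_one_div {r : ℝ} (h0 : 0 < r) :
    Real.log (Real.exp 1 / r) = 1 + Real.log (1 / r) := by
  rw [Real.log_div (Real.exp_pos 1).ne' h0.ne', Real.log_exp, one_div, Real.log_inv]
  ring

theorem deriv_profile_logPotential_nonneg {n : ℕ} (hn : 1 ≤ n) {δ c ε r : ℝ} (hδ : 0 ≤ δ)
    (hc : 0 ≤ c) (hε : 0 ≤ ε) (h0 : 0 < r) (h1 : r ≤ 1) :
    0 ≤ deriv (profile (logPotential δ c ε : EuclideanSpace ℝ (Fin n) → ℝ)) r := by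
  rw [deriv_profile_logPotential hn δ c hε h0 h1]
  have := regLog_nonneg (ε := ε) (s := r ^ 2) (by positivity) (pow_le_one₀ h0.le h1)
  positivity

theorem mul_deriv_profile_logPotential_le {n : ℕ} (hn : 1 ≤ n) {δ c ε r : ℝ} (hδ0 : 0 ≤ δ)
    (hδ1 : δ ≤ 1) (hc : 0 ≤ c) (hε : 0 ≤ ε) (hε1 : ε ≤ 1) (h0 : 0 < r) (h1 : r ≤ 1) :
    r * deriv (profile (logPotential δ c ε : EuclideanSpace ℝ (Fin n) → ℝ)) r ≤
      c * δ * (1 + Real.log (1 / r)) ^ (δ - 1) := by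
  rw [deriv_profile_logPotential hn δ c hε h0 h1]
  have := mul_le_mul_of_nonneg_left (regLog_rpow_mul_le hδ0 hδ1 hε hε1 h0 h1)
    (mul_nonneg hc hδ0)
  refine le_of_eq_of_le ?_ this
  ring

theorem logPotential_regular {n : ℕ} (hn : 1 ≤ n) {δ c ε : ℝ} (hδ0 : 0 ≤ δ) (hδ1 : δ ≤ 1)
    (hc : 0 ≤ c) (hε : 0 ≤ ε) (hε1 : ε ≤ 1) :
    (∀ a b : ℝ, 0 < a → a < b → b < 1 → AbsolutelyContinuousOnInterval
      (profile (logPotential δ c ε : EuclideanSpace ℝ (Fin n) → ℝ)) a b) ∧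
    Tendsto (profile (logPotential δ c ε : EuclideanSpace ℝ (Fin n) → ℝ)) (𝓝[<] 1) (𝓝 0) := by
  have hp : profile (logPotential δ c ε : EuclideanSpace ℝ (Fin n) → ℝ) =
      fun r => logProfile δ c ε (r ^ 2) := funext fun r => profile_logPotential hn δ c ε r
  have hd : ∀ r : ℝ, 0 < r → r ≤ 1 →
      HasDerivAt (profile (logPotential δ c ε : EuclideanSpace ℝ (Fin n) → ℝ))
        (deriv (profile (logPotential δ c ε : EuclideanSpace ℝ (Fin n) → ℝ)) r) r := by
    intro r h0 h1
    rw [deriv_profile_logPotential hn δ c hε h0 h1, hp]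
    exact hasDerivAt_logProfile_sq δ c hε (by positivity) (pow_le_one₀ h0.le h1)
  constructor
  · intro a b ha hab hb
    refine absolutelyContinuous_of_hasDerivAt_bound (C := c * δ / a) hab.le
      (fun r hr => hd r (ha.trans_le hr.1) (hr.2.trans hb.le)) fun r hr => ?_
    have h0 := ha.trans_le hr.1
    have h1 := hr.2.trans hb.le
    rw [abs_of_nonneg (deriv_profile_logPotential_nonneg hn hδ0 hc hε h0 h1), le_div_iff₀ ha]
    have hl : 0 ≤ Real.log (1 / r) :=
      Real.log_nonneg (by rw [one_div]; exact (one_le_inv₀ h0).2 h1)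
    have h2 : (1 + Real.log (1 / r)) ^ (δ - 1) ≤ 1 :=
      Real.rpow_le_one_of_one_le_of_nonpos (by linarith) (by linarith)
    have h3 := mul_deriv_profile_logPotential_le hn hδ0 hδ1 hc hε hε1 h0 h1
    have h4 := deriv_profile_logPotential_nonneg hn hδ0 hc hε h0 h1
    have h5 := mul_le_mul_of_nonneg_left h2 (mul_nonneg hc hδ0)
    have h6 := mul_le_mul_of_nonneg_left hr.1 h4
    linarith
  · have h2 := (hd 1 one_pos le_rfl).continuousAt.tendsto
    have h3 : profile (logPotential δ c ε : EuclideanSpace ℝ (Fin n) → ℝ) 1 = 0 := by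
      rw [hp]; simp [logProfile_one δ c hε]
    rw [h3] at h2
    exact h2.mono_left nhdsWithin_le_nhds

/-- The slope is nonnegative, so its integral is the total rise of the profile, from the centre to
the boundary value 0. -/
theorem lintegral_deriv_profile_logPotential {n : ℕ} (hn : 1 ≤ n) {δ c ε : ℝ} (hδ0 : 0 ≤ δ)
    (hc : 0 ≤ c) (hε : 0 < ε) :
    ∫⁻ r in Ioo (0 : ℝ) 1, ENNReal.ofReal
      (deriv (profile (logPotential δ c ε : EuclideanSpace ℝ (Fin n) → ℝ)) r) =
      ENNReal.ofReal (c * ((1 + regLog ε 0) ^ δ - 1)) := by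
  set g : ℝ → ℝ := fun r => c * δ * ((1 + regLog ε (r ^ 2)) ^ (δ - 1) * (r / (r ^ 2 + ε))) with hg
  have hd : ∀ r ∈ Icc (0 : ℝ) 1, HasDerivAt (fun r => logProfile δ c ε (r ^ 2)) (g r) r :=
    fun r hr => hasDerivAt_logProfile_sq δ c hε.le (by positivity) (pow_le_one₀ hr.1 hr.2)
  have hgpos : ∀ r ∈ Ioo (0 : ℝ) 1, 0 ≤ g r := by
    intro r hr
    have h0 := hr.1
    have := regLog_nonneg (ε := ε) (s := r ^ 2) (by positivity) (pow_le_one₀ hr.1.le hr.2.le)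
    positivity
  have hint : IntervalIntegrable g volume 0 1 := by
    refine intervalIntegral.intervalIntegrable_deriv_of_nonneg
      (g := fun r => logProfile δ c ε (r ^ 2)) ?_ ?_ ?_
    · rw [uIcc_of_le zero_le_one]
      exact fun r hr => (hd r hr).continuousAt.continuousWithinAt
    · simpa using fun r h0 h1 => hd r ⟨h0.le, h1.le⟩
    · simpa using fun r h0 h1 => hgpos r ⟨h0, h1⟩
  have hftc := intervalIntegral.integral_eq_sub_of_hasDerivAt
    (fun r hr => hd r (by rwa [uIcc_of_le zero_le_one] at hr)) hint
  rw [intervalIntegral.integral_of_le zero_le_one, integral_Ioc_eq_integral_Ioo] at hftc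
  have hval : logProfile δ c ε ((1 : ℝ) ^ 2) - logProfile δ c ε ((0 : ℝ) ^ 2) =
      c * ((1 + regLog ε 0) ^ δ - 1) := by
    rw [one_pow, logProfile_one δ c hε.le, zero_pow two_ne_zero, logProfile]
    ring
  rw [setLIntegral_congr_fun measurableSet_Ioo fun r hr => by
    rw [deriv_profile_logPotential hn δ c hε.le hr.1 hr.2.le],
    ← ofReal_integral_eq_lintegral_ofReal (hint.1.mono_set Ioo_subset_Ioc_self)
      ((ae_restrict_iff' measurableSet_Ioo).2 (Eventually.of_forall hgpos)), hftc, hval]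

/-- For δ = 1 - β the density is (r v' (1 + ln(1/r))^β)^k v', whose first factor is at most (cδ)^k.
Only the integral of v' remains, so no constant is lost, which sharpness in α requires. -/
theorem weightedNorm_logPotential_le {k : ℕ} (hk : 1 ≤ k) {β : ℝ} (hβ0 : 0 ≤ β) (hβ1 : β < 1)
    {c ε : ℝ} (hc : 0 ≤ c) (hε : 0 < ε) (hε1 : ε ≤ 1) :
    weightedNorm k (logWeightOne (2 * k) β)
      (logPotential (1 - β) c ε : EuclideanSpace ℝ (Fin (2 * k)) → ℝ) ≤
      ENNReal.ofReal (cConst (2 * k) k * ((c * (1 - β)) ^ k *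
        (c * ((1 + regLog ε 0) ^ (1 - β) - 1)))) ^ (1 / ((k : ℝ) + 1)) := by
  have hn : 1 ≤ 2 * k := by omega
  have hθ : 0 < 1 - β := by linarith
  have hθc : 0 ≤ c * (1 - β) := by positivity
  unfold weightedNorm
  refine ENNReal.rpow_le_rpow ?_ (by positivity)
  rw [ENNReal.ofReal_mul (cConst_pos hk).le, ENNReal.ofReal_mul (by positivity),
    ← lintegral_deriv_profile_logPotential hn hθ.le hc hε, ← lintegral_const_mul'
      (ENNReal.ofReal ((c * (1 - β)) ^ k)) _ ENNReal.ofReal_ne_top]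
  refine mul_le_mul' le_rfl ?_
  refine setLIntegral_mono' measurableSet_Ioo fun r hr => ?_
  obtain ⟨h0, h1⟩ := hr
  rw [← ENNReal.ofReal_mul (by positivity)]
  refine ENNReal.ofReal_le_ofReal ?_
  set v' := deriv (profile (logPotential (1 - β) c ε : EuclideanSpace ℝ (Fin (2 * k)) → ℝ)) r
  have hv0 : 0 ≤ v' := deriv_profile_logPotential_nonneg hn hθ.le hc hε.le h0 h1.le
  have hv1 : r * v' ≤ c * (1 - β) * (1 + Real.log (1 / r)) ^ (1 - β - 1) :=
    mul_deriv_profile_logPotential_le hn hθ.le (by linarith) hc hε.le hε1 h0 h1.le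
  have hl : 0 < 1 + Real.log (1 / r) := by linarith [log_one_div_pos h0 h1]
  have e1 : 2 * k - k = k := by omega
  have e2 : logWeightOne (2 * k) β r = ((1 + Real.log (1 / r)) ^ β) ^ k := by
    rw [logWeightOne, log_exp_one_div h0, ← Real.rpow_natCast, ← Real.rpow_mul hl.le]
    congr 1
    push_cast; ring
  rw [e1, e2, abs_of_nonneg hv0]
  have hb : 0 < (1 + Real.log (1 / r)) ^ β := by positivity
  have h3 : r * v' * (1 + Real.log (1 / r)) ^ β ≤ c * (1 - β) := by
    calc _ ≤ c * (1 - β) * (1 + Real.log (1 / r)) ^ (1 - β - 1) *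
          (1 + Real.log (1 / r)) ^ β := mul_le_mul_of_nonneg_right hv1 hb.le
      _ = _ := by
        rw [mul_assoc, ← Real.rpow_add hl]
        simp
  calc r ^ k * v' ^ (k + 1) * ((1 + Real.log (1 / r)) ^ β) ^ k
      = (r * v' * (1 + Real.log (1 / r)) ^ β) ^ k * v' := by ring
    _ ≤ _ := by gcongr

/-! ### Sharpness of the constant α -/

/-- The ball of radius e^(-m) has e^(-nm) times the volume of B. The origin is excluded because the
potential with ε = 0 is singular there and takes the default value 0. -/
theorem le_expIntegral {n : ℕ} (hn : 1 ≤ n) {α γ y m : ℝ} (hα : 0 ≤ α) (hγ : 0 ≤ γ) (hy : 0 ≤ y)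
    (hm : 0 ≤ m) {u : EuclideanSpace ℝ (Fin n) → ℝ}
    (hu : ∀ x, x ≠ 0 → ‖x‖ < Real.exp (-m) → y ≤ |u x|) :
    volume (Metric.ball (0 : EuclideanSpace ℝ (Fin n)) 1) *
      ENNReal.ofReal (Real.exp (α * y ^ γ - n * m)) ≤ expIntegral α γ u := by
  have : Nonempty (Fin n) := ⟨⟨0, hn⟩⟩
  have hball : Metric.ball (0 : EuclideanSpace ℝ (Fin n)) (Real.exp (-m)) ⊆ Metric.ball 0 1 :=
    Metric.ball_subset_ball (Real.exp_le_one_iff.2 (by linarith))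
  have hvol := Measure.addHaar_ball (volume : Measure (EuclideanSpace ℝ (Fin n))) 0
    (Real.exp_pos (-m)).le
  rw [finrank_euclideanSpace_fin] at hvol
  calc _ = ∫⁻ _ in Metric.ball (0 : EuclideanSpace ℝ (Fin n)) (Real.exp (-m)),
        ENNReal.ofReal (Real.exp (α * y ^ γ)) := by
        rw [setLIntegral_const, hvol, ← mul_assoc, ← ENNReal.ofReal_mul (Real.exp_pos _).le,
          mul_comm, ← Real.exp_nat_mul, ← Real.exp_add]
        congr 3
        ring
    _ ≤ ∫⁻ x in Metric.ball (0 : EuclideanSpace ℝ (Fin n)) (Real.exp (-m)),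
        ENNReal.ofReal (Real.exp (α * |u x| ^ γ)) := by
        refine lintegral_mono_ae ?_
        have hne : ∀ᵐ x : EuclideanSpace ℝ (Fin n)
            ∂(volume.restrict (Metric.ball 0 (Real.exp (-m)))), x ≠ 0 :=
          ae_restrict_of_ae (by simp [ae_iff])
        filter_upwards [hne, ae_restrict_mem measurableSet_ball] with x hx hxb
        have := hu x hx (by simpa using hxb)
        gcongr
    _ ≤ _ := lintegral_mono_set hball

theorem volume_ball_mul_eq_top_of_tendsto {n : ℕ} {I : ENNReal} {F : ℝ → ℝ}
    (hF : Tendsto F atTop atTop)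
    (h : ∀ᶠ m in atTop, volume (Metric.ball (0 : EuclideanSpace ℝ (Fin n)) 1) *
      ENNReal.ofReal (Real.exp (F m)) ≤ I) : I = ⊤ := by
  have h0 : volume (Metric.ball (0 : EuclideanSpace ℝ (Fin n)) 1) ≠ 0 :=
    (Metric.measure_ball_pos _ _ one_pos).ne'
  have h1 : Tendsto (fun m => ENNReal.ofReal (Real.exp (F m))) atTop (𝓝 ⊤) :=
    ENNReal.tendsto_ofReal_atTop.comp (Real.tendsto_exp_atTop.comp hF)
  have h2 := ENNReal.Tendsto.const_mul (a := volume (Metric.ball (0 : EuclideanSpace ℝ (Fin n)) 1))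
    h1 (Or.inl ENNReal.top_ne_zero)
  rw [ENNReal.mul_top h0] at h2
  exact top_le_iff.1 (le_of_tendsto h2 h)

theorem le_abs_logPotential {n : ℕ} {δ c ε y : ℝ} (hδ : 0 ≤ δ) (hc : 0 ≤ c) (hy : 1 ≤ y)
    {x : EuclideanSpace ℝ (Fin n)} (h : y ≤ 1 + regLog ε (‖x‖ ^ 2)) :
    c * (y ^ δ - 1) ≤ |logPotential δ c ε x| := by
  have h1 : y ^ δ ≤ (1 + regLog ε (‖x‖ ^ 2)) ^ δ := Real.rpow_le_rpow (by linarith) h hδ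
  rw [logPotential, logProfile, abs_mul, abs_of_nonneg hc, abs_sub_comm]
  gcongr
  exact le_trans (by linarith) (le_abs_self _)

/-- At scale ε = e^(-2m) the regularized logarithm is m up to bounded error on |x| ≤ e^(-m); the
additive 1 absorbs the error (ln 2)/2. -/
theorem regLog_exp_bounds {m : ℝ} (hm : 0 ≤ m) :
    1 + regLog (Real.exp (-(2 * m))) 0 ≤ m + 2 ∧
    ∀ s, 0 ≤ s → s ≤ Real.exp (-(2 * m)) → m ≤ 1 + regLog (Real.exp (-(2 * m))) s := by
  have hlog2 : Real.log 2 ≤ 1 := by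
    have := Real.log_le_sub_one_of_pos (two_pos (α := ℝ))
    linarith
  have hE : Real.exp (-(2 * m)) ≤ 1 := Real.exp_le_one_iff.2 (by linarith)
  have hE0 := Real.exp_pos (-(2 * m))
  have hl : Real.log (1 + Real.exp (-(2 * m))) ≤ Real.log 2 :=
    Real.log_le_log (by positivity) (by linarith)
  have hl0 : 0 ≤ Real.log (1 + Real.exp (-(2 * m))) := Real.log_nonneg (by linarith)
  constructor
  · unfold regLog
    rw [zero_add, Real.log_div (by positivity) hE0.ne', Real.log_exp]
    linarith
  · intro s hs hsE
    unfold regLog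
    rw [Real.log_div (by positivity) (by positivity)]
    have : Real.log (s + Real.exp (-(2 * m))) ≤ Real.log 2 + -(2 * m) := by
      rw [← Real.log_exp (-(2 * m)), ← Real.log_mul two_ne_zero hE0.ne', Real.log_exp]
      exact Real.log_le_log (by positivity) (by linarith)
    linarith

theorem mem_PhiRadWeighted_of_mem_PhiRad {n k : ℕ} {w : ℝ → ℝ}
    {u : EuclideanSpace ℝ (Fin n) → ℝ} (h1 : u ∈ RadialSobolev n k w) (h2 : u ∈ PhiRad n k) :
    u ∈ PhiRadWeighted n k w := by
  refine ⟨h1, fun ε hε => ⟨u, h2, h1.2.2.2, ?_⟩⟩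
  have : weightedNorm k w (u - u) = 0 := by
    unfold weightedNorm
    have hp : profile (u - u) = fun _ => 0 := by
      ext r; simp [profile]
    rw [hp]
    simp
    positivity
  rw [this]
  exact hε

/-- The exponent produced by the concentrating family, with q = α/α_{n,β}; the factors other than q
inside the bracket tend to 1. -/
theorem tendsto_exponent_atTop {k : ℕ} (hk : 1 ≤ k) {θ γ q : ℝ} (hθ : 0 < θ)
    (hq : 1 < q) :
    Tendsto (fun m : ℝ => 2 * (k : ℝ) * m *
      (q * ((m / (m + 2)) ^ (1 / (k : ℝ)) * (1 - m ^ (-θ)) ^ γ) - 1)) atTop atTop := by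
  have hk0 : (0 : ℝ) < k := by exact_mod_cast hk
  have h1 : Tendsto (fun m : ℝ => m / (m + 2)) atTop (𝓝 1) := by
    have h2 : Tendsto (fun m : ℝ => 1 - 2 * (m + 2)⁻¹) atTop (𝓝 (1 - 2 * 0)) :=
      tendsto_const_nhds.sub ((tendsto_inv_atTop_zero.comp
        (tendsto_atTop_add_const_right _ 2 tendsto_id)).const_mul 2)
    rw [mul_zero, sub_zero] at h2
    refine h2.congr' ?_
    filter_upwards [eventually_gt_atTop 0] with m hm
    field_simp
    ring
  have h3 : Tendsto (fun m : ℝ => 1 - m ^ (-θ)) atTop (𝓝 1) := by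
    simpa using (tendsto_rpow_neg_atTop hθ).const_sub 1
  have h4 := (((h1.rpow_const (p := 1 / (k : ℝ)) (Or.inl one_ne_zero)).mul
    (h3.rpow_const (p := γ) (Or.inl one_ne_zero))).const_mul q).sub_const 1
  simp only [Real.one_rpow, mul_one] at h4
  exact (tendsto_id.const_mul_atTop (by positivity : 0 < 2 * (k : ℝ))).atTop_mul_pos
    (by linarith) h4

theorem moserSup_eq_top {k : ℕ} (hk : 1 ≤ k) {β : ℝ} (hβ0 : 0 ≤ β) (hβ1 : β < 1) {w : ℝ → ℝ}
    (hw : ∀ r ∈ Ioo (0 : ℝ) 1, w r ≤ logWeightOne (2 * k) β r) {α : ℝ}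
    (hα : alphaCrit (2 * k) k β < α) : moserSup (2 * k) k w α β = ⊤ := by
  have hk0 : (0 : ℝ) < k := by exact_mod_cast hk
  have hθ : 0 < 1 - β := by linarith
  have hn : 1 ≤ 2 * k := by omega
  have hcn := cConst_pos hk
  have hαc := alphaCrit_pos hk hβ1
  have hγc := gammaCrit_pos hk hβ1
  set θ := 1 - β with hθdef
  set D := cConst (2 * k) k * θ ^ k with hD
  have hD0 : 0 < D := by positivity
  have hαcD : alphaCrit (2 * k) k β = 2 * k * D ^ (1 / (k * θ)) := by
    rw [alphaCrit_eq, ← hθdef, hD]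
    congr 1
    rw [Real.mul_rpow (by positivity) hθ.le, Real.mul_rpow hcn.le (by positivity),
      ← Real.rpow_mul hcn.le, ← Real.rpow_natCast, ← Real.rpow_mul hθ.le]
    congr 2 <;> field_simp
  -- Normalization: c^(k+1) D (m+2)^θ = 1, and the left side bounds the (k+1)-st power of the norm.
  set c : ℝ → ℝ := fun m => (D * (m + 2) ^ θ) ^ (-(1 / ((k : ℝ) + 1))) with hcdef
  refine volume_ball_mul_eq_top_of_tendsto (n := 2 * k)
    (tendsto_exponent_atTop hk (γ := gammaCrit (2 * k) β) hθ ((one_lt_div hαc).2 hα)) ?_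
  filter_upwards [eventually_ge_atTop 1] with m hm
  have hm0 : 0 < m := by linarith
  have hc0 : 0 < c m := by positivity
  have hcpow : c m ^ (k + 1) = (D * (m + 2) ^ θ)⁻¹ := by
    rw [hcdef]
    simp only
    rw [← Real.rpow_natCast, ← Real.rpow_mul (by positivity), ← Real.rpow_neg_one]
    congr 1
    push_cast
    field_simp
  set ε := Real.exp (-(2 * m)) with hε
  have hε0 : 0 < ε := Real.exp_pos _
  have hε1 : ε ≤ 1 := Real.exp_le_one_iff.2 (by linarith)
  obtain ⟨hupper, hlower⟩ := regLog_exp_bounds hm0.le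
  rw [← hε] at hupper hlower
  set u : EuclideanSpace ℝ (Fin (2 * k)) → ℝ := logPotential θ (c m) ε with hu
  have hnorm : weightedNorm k w u ≤ 1 := by
    refine (weightedNorm_mono_weight u hw).trans
      ((weightedNorm_logPotential_le hk hβ0 hβ1 hc0.le hε0 hε1).trans ?_)
    rw [← ENNReal.one_rpow (1 / ((k : ℝ) + 1))]
    refine ENNReal.rpow_le_rpow (ENNReal.ofReal_le_one.2 ?_) (by positivity)
    have hτ : 0 ≤ regLog ε 0 := regLog_nonneg (by linarith) zero_le_one
    have h2 : (1 + regLog ε 0) ^ θ - 1 ≤ (m + 2) ^ θ := by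
      have := Real.rpow_le_rpow (by positivity) hupper hθ.le
      linarith
    calc cConst (2 * k) k * ((c m * θ) ^ k * (c m * ((1 + regLog ε 0) ^ θ - 1)))
        ≤ cConst (2 * k) k * ((c m * θ) ^ k * (c m * (m + 2) ^ θ)) := by gcongr
      _ = c m ^ (k + 1) * (D * (m + 2) ^ θ) := by rw [hD]; ring_nf
      _ = 1 := by rw [hcpow]; exact inv_mul_cancel₀ (by positivity)
  obtain ⟨hac, hlim⟩ := logPotential_regular hn hθ.le (by linarith) hc0.le hε0.le hε1
  have hmem : u ∈ PhiRadWeighted (2 * k) k w := mem_PhiRadWeighted_of_mem_PhiRad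
    ⟨isRadial_logPotential _ _ _, hac, hlim, hnorm.trans_lt ENNReal.one_lt_top⟩
    (logPotential_mem_PhiRad hθ (by linarith) hc0 hε0)
  have hmθ : 1 ≤ m ^ θ := Real.one_le_rpow hm hθ.le
  have hy0 : 0 ≤ c m * (m ^ θ - 1) := mul_nonneg hc0.le (by linarith)
  have hlow := le_expIntegral hn (hαc.le.trans hα.le) hγc.le hy0 hm0.le (u := u) fun x _ hx => by
    refine le_abs_logPotential hθ.le hc0.le hm (hlower _ (by positivity) ?_)
    have : ‖x‖ ^ 2 ≤ Real.exp (-m) ^ 2 := by gcongr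
    rw [← Real.exp_nat_mul] at this
    refine this.trans_eq ?_
    rw [hε]
    congr 1
    push_cast
    ring
  refine le_trans (le_of_eq ?_) (hlow.trans (le_sSup ⟨u, ⟨hmem, hnorm⟩, rfl⟩))
  congr 3
  have hfac : m ^ θ - 1 = m ^ θ * (1 - m ^ (-θ)) := by
    rw [mul_sub, ← Real.rpow_add hm0]
    simp
  have hx0 : 0 ≤ 1 - m ^ (-θ) := by
    have := Real.rpow_le_one_of_one_le_of_nonpos hm (by linarith : -θ ≤ 0)
    linarith
  rw [hfac, Real.mul_rpow hc0.le (by positivity), Real.mul_rpow (by positivity) hx0, hcdef]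
  simp only
  rw [← Real.rpow_mul (by positivity), ← Real.rpow_mul hm0.le,
    Real.mul_rpow hD0.le (by positivity), ← Real.rpow_mul (by positivity),
    Real.div_rpow hm0.le (by positivity), hαcD]
  -- Since θγ = 1 + 1/k, the powers of m and m + 2 combine to m (m/(m+2))^(1/k), while D^(-1/(kθ)) =
  -- 2k/α_{n,β}.
  have e1 : -(1 / ((k : ℝ) + 1)) * gammaCrit (2 * k) β = -(1 / (k * θ)) := by
    rw [gammaCrit_eq, ← hθdef]; field_simp
  have e2 : θ * -(1 / (k * θ)) = -(1 / (k : ℝ)) := by field_simp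
  have e3 : θ * gammaCrit (2 * k) β = 1 + 1 / (k : ℝ) := by
    rw [gammaCrit_eq, ← hθdef]; field_simp
  rw [e1, e2, e3, Real.rpow_neg hD0.le,
    Real.rpow_neg (by positivity : 0 ≤ m + 2), Real.rpow_add hm0,
    Real.rpow_one]
  have p1 : 0 < D ^ (1 / (k * θ)) := by positivity
  have p2 : 0 < (m + 2) ^ (1 / (k : ℝ)) := by positivity
  push_cast
  field_simp

/-! ### Sharpness of the exponent γ -/

theorem measurable_logWeightOne (n : ℕ) (β : ℝ) : Measurable (logWeightOne n β) := by
  unfold logWeightOne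
  fun_prop

theorem measurable_logWeightZero (n : ℕ) (β : ℝ) : Measurable (logWeightZero n β) := by
  unfold logWeightZero
  fun_prop

/-- The weighted energy density of the slope `δ (1 + ln (1/r))^(δ-1) / r`. -/
def slopeDensity (k : ℕ) (β δ r : ℝ) : ENNReal :=
  ENNReal.ofReal (r ^ k * (δ * (1 + Real.log (1 / r)) ^ (δ - 1) / r) ^ (k + 1) *
    logWeightOne (2 * k) β r)

/-- In the variable t the density is a multiple of (1+t)^q with q = (δ-1)(k+1) + βk; the hypothesis
says exactly that q < -1. -/
theorem lintegral_slopeDensity_lt_top {k : ℕ} {β δ : ℝ} (hδ : δ * (k + 1) < k * (1 - β)) :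
    ∫⁻ r in Ioo (0 : ℝ) 1, slopeDensity k β δ r < ⊤ := by
  rw [lintegral_Ioo_zero_one_eq]
  set q : ℝ := (δ - 1) * (k + 1) + β * k with hq
  have hq1 : q < -1 := by rw [hq]; linarith
  have hpt : ∀ t ∈ Ioi (0 : ℝ), ENNReal.ofReal (Real.exp (-t)) *
      slopeDensity k β δ (Real.exp (-t)) = ENNReal.ofReal (δ ^ (k + 1) * (t + 1) ^ q) := by
    intro t ht
    have ht0 : 0 < t := ht
    have h1 : 0 < t + 1 := by linarith
    rw [slopeDensity, ← ENNReal.ofReal_mul (Real.exp_pos _).le, logWeightOne,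
      log_exp_one_div (Real.exp_pos _)]
    congr 1
    simp only [one_div, Real.log_inv, Real.log_exp, neg_neg]
    rw [add_comm 1 t, hq, Real.rpow_add h1, Real.rpow_mul h1.le]
    have e1 : β * ((2 * k : ℕ) : ℝ) / 2 = β * k := by push_cast; ring
    have e2 : ((t + 1) ^ (δ - 1)) ^ ((k : ℝ) + 1) = ((t + 1) ^ (δ - 1)) ^ (k + 1) := by
      rw [← Real.rpow_natCast]; push_cast; rfl
    have hE := Real.exp_pos (-t)
    rw [e1, e2, div_pow, mul_pow]
    field_simp
    ring
  rw [setLIntegral_congr_fun measurableSet_Ioi hpt]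
  exact ((integrableOn_add_rpow_Ioi_of_lt hq1 (by norm_num)).const_mul _).lintegral_lt_top

theorem ofReal_density_le_slopeDensity {k : ℕ} {β δ : ℝ} {w : ℝ → ℝ} {r y : ℝ} (h0 : 0 < r)
    (hw0 : 0 ≤ w r) (hw1 : w r ≤ logWeightOne (2 * k) β r)
    (hy : |y| ≤ δ * (1 + Real.log (1 / r)) ^ (δ - 1) / r) :
    ENNReal.ofReal (r ^ (2 * k - k) * |y| ^ (k + 1) * w r) ≤ slopeDensity k β δ r := by
  have e1 : 2 * k - k = k := by omega
  rw [e1]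
  refine ENNReal.ofReal_le_ofReal ?_
  have hs := (abs_nonneg y).trans hy
  exact mul_le_mul (by gcongr) hw1 hw0 (by positivity)

theorem deriv_profile_logPotential_mem_Icc {n : ℕ} (hn : 1 ≤ n) {δ ε r : ℝ} (hδ0 : 0 ≤ δ)
    (hδ1 : δ ≤ 1) (hε : 0 ≤ ε) (hε1 : ε ≤ 1) (h0 : 0 < r) (h1 : r ≤ 1) :
    deriv (profile (logPotential δ 1 ε : EuclideanSpace ℝ (Fin n) → ℝ)) r ∈
      Icc 0 (δ * (1 + Real.log (1 / r)) ^ (δ - 1) / r) := by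
  refine ⟨deriv_profile_logPotential_nonneg hn hδ0 zero_le_one hε h0 h1, ?_⟩
  rw [le_div_iff₀ h0, mul_comm]
  simpa using mul_deriv_profile_logPotential_le hn hδ0 hδ1 zero_le_one hε hε1 h0 h1

theorem weightedNorm_lt_top_of_lintegral {n k : ℕ} {w : ℝ → ℝ}
    {u : EuclideanSpace ℝ (Fin n) → ℝ}
    (h : ∫⁻ r in Ioo (0 : ℝ) 1,
      ENNReal.ofReal (r ^ (n - k) * |deriv (profile u) r| ^ (k + 1) * w r) < ⊤) :
    weightedNorm k w u < ⊤ :=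
  ENNReal.rpow_lt_top_of_nonneg (by positivity) (ENNReal.mul_lt_top ENNReal.ofReal_lt_top h).ne

section
variable {k : ℕ} {β δ : ℝ} {w : ℝ → ℝ}

theorem logPotential_mem_RadialSobolev (hk : 1 ≤ k) (hw0 : ∀ r ∈ Ioo (0 : ℝ) 1, 0 ≤ w r)
    (hw1 : ∀ r ∈ Ioo (0 : ℝ) 1, w r ≤ logWeightOne (2 * k) β r) (hδ0 : 0 ≤ δ) (hδ1 : δ ≤ 1)
    (hδ : δ * (k + 1) < k * (1 - β)) {ε : ℝ} (hε : 0 ≤ ε) (hε1 : ε ≤ 1) :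
    (logPotential δ 1 ε : EuclideanSpace ℝ (Fin (2 * k)) → ℝ) ∈ RadialSobolev (2 * k) k w := by
  have hn : 1 ≤ 2 * k := by omega
  obtain ⟨hac, hlim⟩ := logPotential_regular (n := 2 * k) hn hδ0 hδ1 zero_le_one hε hε1
  refine ⟨isRadial_logPotential _ _ _, hac, hlim, weightedNorm_lt_top_of_lintegral ?_⟩
  refine (setLIntegral_mono' measurableSet_Ioo fun r hr => ?_).trans_lt
    (lintegral_slopeDensity_lt_top hδ)
  have := deriv_profile_logPotential_mem_Icc hn hδ0 hδ1 hε hε1 hr.1 hr.2.le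
  exact ofReal_density_le_slopeDensity hr.1 (hw0 r hr) (hw1 r hr)
    (by rw [abs_of_nonneg this.1]; exact this.2)

/-- Dominated convergence as ε → 0: all the slopes lie between 0 and the singular slope, whose
energy is finite. -/
theorem tendsto_weightedNorm_logPotential_sub (hk : 1 ≤ k) (hwm : Measurable w)
    (hw0 : ∀ r ∈ Ioo (0 : ℝ) 1, 0 ≤ w r)
    (hw1 : ∀ r ∈ Ioo (0 : ℝ) 1, w r ≤ logWeightOne (2 * k) β r) (hδ0 : 0 ≤ δ) (hδ1 : δ ≤ 1)
    (hδ : δ * (k + 1) < k * (1 - β)) :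
    Tendsto (fun ε => weightedNorm k w
      ((logPotential δ 1 0 : EuclideanSpace ℝ (Fin (2 * k)) → ℝ) - logPotential δ 1 ε))
      (𝓝[>] 0) (𝓝 0) := by
  have hn : 1 ≤ 2 * k := by omega
  have hdiff : ∀ ε, 0 ≤ ε → ∀ r ∈ Ioo (0 : ℝ) 1, deriv (profile
      ((logPotential δ 1 0 : EuclideanSpace ℝ (Fin (2 * k)) → ℝ) - logPotential δ 1 ε)) r =
      δ * ((1 + regLog 0 (r ^ 2)) ^ (δ - 1) * (r / (r ^ 2 + 0))) -
        δ * ((1 + regLog ε (r ^ 2)) ^ (δ - 1) * (r / (r ^ 2 + ε))) := by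
    intro ε hε r hr
    have hp : profile ((logPotential δ 1 0 : EuclideanSpace ℝ (Fin (2 * k)) → ℝ) -
        logPotential δ 1 ε) =
        (fun r => logProfile δ 1 0 (r ^ 2)) - fun r => logProfile δ 1 ε (r ^ 2) := by
      ext r
      rw [Pi.sub_apply, ← profile_logPotential hn, ← profile_logPotential hn]
      rfl
    have h0 := hr.1
    have hle := pow_le_one₀ (n := 2) hr.1.le hr.2.le
    rw [hp, ((hasDerivAt_logProfile_sq δ 1 le_rfl (by positivity) hle).sub
      (hasDerivAt_logProfile_sq δ 1 hε (by positivity) hle)).deriv]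
    simp only [one_mul]
  have hpos : (0 : ℝ) < 1 / ((k : ℝ) + 1) := by positivity
  suffices h : Tendsto (fun ε => ∫⁻ r in Ioo (0 : ℝ) 1, ENNReal.ofReal (r ^ (2 * k - k) *
      |deriv (profile ((logPotential δ 1 0 : EuclideanSpace ℝ (Fin (2 * k)) → ℝ) -
        logPotential δ 1 ε)) r| ^ (k + 1) * w r)) (𝓝[>] 0) (𝓝 0) by
    have h2 := (ENNReal.continuous_rpow_const (y := 1 / ((k : ℝ) + 1))).continuousAt.tendsto.comp
      (ENNReal.Tendsto.const_mul (a := ENNReal.ofReal (cConst (2 * k) k)) h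
        (Or.inr ENNReal.ofReal_ne_top))
    rw [mul_zero, ENNReal.zero_rpow_of_pos hpos] at h2
    exact h2
  have hev : ∀ᶠ ε : ℝ in 𝓝[>] 0, ε ∈ Ioo (0 : ℝ) 1 := Ioo_mem_nhdsGT one_pos
  have hdct := tendsto_lintegral_filter_of_dominated_convergence
    (μ := volume.restrict (Ioo (0 : ℝ) 1)) (l := 𝓝[>] (0 : ℝ))
    (F := fun ε r => ENNReal.ofReal (r ^ (2 * k - k) *
      |deriv (profile ((logPotential δ 1 0 : EuclideanSpace ℝ (Fin (2 * k)) → ℝ) -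
        logPotential δ 1 ε)) r| ^ (k + 1) * w r)) (f := fun _ => 0) (slopeDensity k β δ)
    ?_ ?_ (lintegral_slopeDensity_lt_top hδ).ne ?_
  · simpa using hdct
  · refine Eventually.of_forall fun ε => ?_
    have := measurable_deriv (profile ((logPotential δ 1 0 :
      EuclideanSpace ℝ (Fin (2 * k)) → ℝ) - logPotential δ 1 ε))
    fun_prop
  · filter_upwards [hev] with ε hε
    refine (ae_restrict_iff' measurableSet_Ioo).2 (Eventually.of_forall fun r hr => ?_)
    refine ofReal_density_le_slopeDensity hr.1 (hw0 r hr) (hw1 r hr) ?_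
    have h1 := deriv_profile_logPotential_mem_Icc hn hδ0 hδ1 le_rfl zero_le_one hr.1 hr.2.le
    have h2 := deriv_profile_logPotential_mem_Icc hn hδ0 hδ1 hε.1.le hε.2.le hr.1 hr.2.le
    rw [deriv_profile_logPotential hn δ 1 le_rfl hr.1 hr.2.le, one_mul] at h1
    rw [deriv_profile_logPotential hn δ 1 hε.1.le hr.1 hr.2.le, one_mul] at h2
    rw [hdiff ε hε.1.le r hr, abs_le]
    constructor <;> linarith [h1.1, h1.2, h2.1, h2.2]
  · refine (ae_restrict_iff' measurableSet_Ioo).2 (Eventually.of_forall fun r hr => ?_)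
    have h0 := hr.1
    have hτ := regLog_nonneg (ε := 0) (s := r ^ 2) (by positivity) (pow_le_one₀ hr.1.le hr.2.le)
    set g : ℝ → ℝ := fun ε => δ * ((1 + regLog ε (r ^ 2)) ^ (δ - 1) * (r / (r ^ 2 + ε))) with hg
    have hne : r ^ 2 + 0 ≠ 0 := by positivity
    have hne' : (1 + 0) / (r ^ 2 + 0) ≠ 0 := by positivity
    -- At a fixed r > 0 the slope is continuous in ε at 0, since r² keeps the denominator away from
    -- zero.
    have hden : ContinuousAt (fun ε : ℝ => r ^ 2 + ε) 0 := by fun_prop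
    have hreg : ContinuousAt (fun ε => regLog ε (r ^ 2)) 0 := by
      unfold regLog
      exact (ContinuousAt.log (ContinuousAt.div (by fun_prop) hden hne) hne').div_const 2
    have hgc : ContinuousAt g 0 := continuousAt_const.mul
      (((continuousAt_const.add hreg).rpow_const
        (Or.inl (show 1 + regLog 0 (r ^ 2) ≠ 0 by positivity))).mul
        (continuousAt_const.div hden hne))
    have hlim : Tendsto (fun ε => ENNReal.ofReal (r ^ (2 * k - k) *
        |g 0 - g ε| ^ (k + 1) * w r)) (𝓝[>] 0) (𝓝 0) := by
      have h3 : Tendsto (fun ε => r ^ (2 * k - k) * |g 0 - g ε| ^ (k + 1) * w r) (𝓝[>] 0)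
          (𝓝 (r ^ (2 * k - k) * |g 0 - g 0| ^ (k + 1) * w r)) :=
        (((tendsto_const_nhds.sub (hgc.tendsto.mono_left nhdsWithin_le_nhds)).abs.pow
          _).const_mul _).mul_const _
      have h4 := (ENNReal.continuous_ofReal.tendsto _).comp h3
      simpa [Function.comp_def] using h4
    refine hlim.congr' ?_
    filter_upwards [self_mem_nhdsWithin] with ε hε
    rw [hdiff ε (le_of_lt hε) r hr]

theorem logPotential_zero_mem_PhiRadWeighted (hk : 1 ≤ k) (hwm : Measurable w)
    (hw0 : ∀ r ∈ Ioo (0 : ℝ) 1, 0 ≤ w r)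
    (hw1 : ∀ r ∈ Ioo (0 : ℝ) 1, w r ≤ logWeightOne (2 * k) β r) (hδ0 : 0 < δ) (hδ1 : δ ≤ 1)
    (hδ : δ * (k + 1) < k * (1 - β)) :
    (logPotential δ 1 0 : EuclideanSpace ℝ (Fin (2 * k)) → ℝ) ∈ PhiRadWeighted (2 * k) k w := by
  refine ⟨logPotential_mem_RadialSobolev hk hw0 hw1 hδ0.le hδ1 hδ le_rfl zero_le_one,
    fun η hη => ?_⟩
  have h1 := (tendsto_weightedNorm_logPotential_sub hk hwm hw0 hw1 hδ0.le hδ1 hδ).eventually_lt_const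
    hη
  obtain ⟨ε, h2, hε⟩ := (h1.and (Ioo_mem_nhdsGT one_pos)).exists
  exact ⟨_, logPotential_mem_PhiRad hδ0 hδ1 one_pos hε.1,
    (logPotential_mem_RadialSobolev hk hw0 hw1 hδ0.le hδ1 hδ hε.1.le hε.2.le).2.2.2, h2⟩

/-- With s = 1 + m the first term is s^(δγ) (1 - s^(-δ))^γ, which is superlinear. -/
theorem tendsto_rpow_sub_mul_atTop {γ : ℝ} (N : ℝ) (hδ : 0 < δ)
    (hδγ : 1 < δ * γ) :
    Tendsto (fun m : ℝ => 1 * ((1 + m) ^ δ - 1) ^ γ - N * m) atTop atTop := by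
  suffices h : Tendsto (fun s : ℝ => (s ^ δ - 1) ^ γ - N * (s - 1)) atTop atTop by
    refine (h.comp (tendsto_atTop_add_const_left _ 1 tendsto_id)).congr fun m => ?_
    simp
  have h3 : Tendsto (fun s : ℝ => 1 - s ^ (-δ)) atTop (𝓝 1) := by
    simpa using (tendsto_rpow_neg_atTop hδ).const_sub 1
  have h4 := h3.rpow_const (p := γ) (Or.inl one_ne_zero)
  rw [Real.one_rpow] at h4
  have h5 := (tendsto_rpow_atTop (sub_pos.2 hδγ)).atTop_mul_pos one_pos h4
  have h6 := tendsto_id.atTop_mul_atTop₀ (tendsto_atTop_add_const_right _ (-N) h5)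
  refine (tendsto_atTop_add_const_right _ N h6).congr' ?_
  filter_upwards [eventually_ge_atTop 1] with s hs
  have hs0 : 0 < s := by linarith
  have hx0 : 0 ≤ 1 - s ^ (-δ) := by
    have := Real.rpow_le_one_of_one_le_of_nonpos hs (by linarith : -δ ≤ 0)
    linarith
  have hfac : s ^ δ - 1 = s ^ δ * (1 - s ^ (-δ)) := by
    rw [mul_sub, ← Real.rpow_add hs0]
    simp
  rw [hfac, Real.mul_rpow (by positivity) hx0, ← Real.rpow_mul hs0.le,
    Real.rpow_sub hs0, Real.rpow_one]
  simp only [id]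
  field_simp
  ring

theorem expIntegral_logPotential_zero_eq_top {n : ℕ} (hn : 1 ≤ n) {γ : ℝ} (hγ : 0 ≤ γ)
    (hδ : 0 < δ) (hδγ : 1 < δ * γ) :
    expIntegral 1 γ (logPotential δ 1 0 : EuclideanSpace ℝ (Fin n) → ℝ) = ⊤ := by
  refine volume_ball_mul_eq_top_of_tendsto (n := n)
    (tendsto_rpow_sub_mul_atTop (n : ℝ) hδ hδγ) ?_
  filter_upwards [eventually_ge_atTop 0] with m hm
  have h1 : 1 ≤ (1 + m) ^ δ := Real.one_le_rpow (by linarith) hδ.le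
  refine le_expIntegral hn zero_le_one hγ (by linarith) hm fun x hx hxm => ?_
  have hx0 := norm_pos_iff.2 hx
  have h2 : m ≤ regLog 0 (‖x‖ ^ 2) := by
    have h3 := Real.log_le_log hx0 hxm.le
    rw [Real.log_exp] at h3
    unfold regLog
    rw [add_zero, add_zero, one_div, Real.log_inv, Real.log_pow]
    push_cast
    linarith
  simpa using le_abs_logPotential (c := 1) hδ.le zero_le_one (by linarith : 1 ≤ 1 + m)
    (add_le_add_right h2 1)

end

end

/-! ### Conclusion -/

theorem theorem1 (n k : ℕ) (hk : 1 ≤ k) (hn : n = 2 * k) (β : ℝ) (hβ0 : 0 ≤ β) (hβ1 : β < 1)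
    (w : ℝ → ℝ) (hw : w = logWeightZero n β ∨ w = logWeightOne n β) :
    (∀ γ : ℝ, 0 ≤ γ →
      ((∀ u ∈ PhiRadWeighted n k w, expIntegral 1 γ u < ⊤) ↔ γ ≤ gammaCrit n β)) ∧
    (∀ α : ℝ, (moserSup n k w α β < ⊤ ↔ α ≤ alphaCrit n k β)) := by
  subst hn
  have hk0 : (0 : ℝ) < k := by exact_mod_cast hk
  have hθ : 0 < 1 - β := by linarith
  have hwm : Measurable w := by
    rcases hw with rfl | rfl
    exacts [measurable_logWeightZero _ _, measurable_logWeightOne _ _]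
  have hw0 : ∀ r ∈ Ioo (0 : ℝ) 1, 0 ≤ w r := by
    intro r hr
    have hl := log_one_div_pos hr.1 hr.2
    rcases hw with rfl | rfl
    · exact Real.rpow_nonneg hl.le _
    · refine Real.rpow_nonneg ?_ _
      rw [log_exp_one_div hr.1]
      linarith
  have hw1 : ∀ r ∈ Ioo (0 : ℝ) 1, w r ≤ logWeightOne (2 * k) β r := by
    intro r hr
    rcases hw with rfl | rfl
    exacts [logWeightZero_le_logWeightOne hβ0 hr.1 hr.2, le_rfl]
  have hγc := gammaCrit_pos hk hβ1
  refine ⟨fun γ hγ => ⟨fun h => ?_, fun h u hu => ?_⟩, fun α => ⟨fun h => ?_, fun h => ?_⟩⟩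
  · by_contra hlt
    rw [not_le] at hlt
    have hγ0 : 0 < γ := hγc.trans hlt
    -- The bound δ > 1/γ makes the exponential integral diverge; δ < 1/γ_{n,β} keeps the energy
    -- finite.
    obtain ⟨δ, hδ1, hδ2⟩ := exists_between (one_div_lt_one_div_of_lt hγc hlt)
    have hδ0 : 0 < δ := lt_trans (by positivity) hδ1
    have hδ : δ * (k + 1) < k * (1 - β) := by
      rwa [gammaCrit_eq, one_div_div, lt_div_iff₀ (by positivity)] at hδ2
    have hδle : δ ≤ 1 := by nlinarith [mul_nonneg hk0.le hβ0]
    have hfin := h _ (logPotential_zero_mem_PhiRadWeighted hk hwm hw0 hw1 hδ0 hδle hδ)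
    rw [expIntegral_logPotential_zero_eq_top (by omega) hγ hδ0
      ((div_lt_iff₀ hγ0).1 hδ1)] at hfin
    exact lt_irrefl _ hfin
  · obtain ⟨⟨hrad, hac, hlim, hnorm⟩, -⟩ := hu
    exact expIntegral_lt_top hk hβ1 hrad hac hlim
      ((totalEnergy_bounds hk hβ0 hw u).1 hnorm) hγ h
  · by_contra hlt
    rw [not_le] at hlt
    rw [moserSup_eq_top hk hβ0 hβ1 hw1 hlt] at h
    exact lt_irrefl _ h
  · obtain ⟨C, hC, hbound⟩ := exists_expIntegral_bound hk hβ0 hβ1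
    refine lt_of_le_of_lt (sSup_le ?_) hC
    rintro _ ⟨u, ⟨⟨⟨hrad, hac, hlim, -⟩, -⟩, hnorm⟩, rfl⟩
    -- The integrand is monotone in α, so the critical α covers all smaller ones, negative values
    -- included.
    refine le_trans (lintegral_mono fun x => ?_)
      (hbound u hrad hac hlim ((totalEnergy_bounds hk hβ0 hw u).2 hnorm))
    gcongr
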